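/- A metrized graph $\Gamma$ is a finite, non-empty, connected graph (self-loops and multiple edges allowed) in which each edge $e$ is parametrized by a segment $[0,L_e]$ with $L_e>0$, regarded as a topological space (the quotient of the disjoint union of the vertices and these segments by the identification of endpoints). Write $\int_\Gamma F\,dx=\sum_e\int_0^{L_e}F\,dt$, where $d/dx$ is the derivative in the parameter of each edge. For $y,z\in\Gamma$, the voltage function $x\mapsto j_z(x,y)$ is the unique continuous, piecewise affine function $f$ on $\Gamma$ with $f(z)=0$ and $\Delta f=\delta_y-\delta_z$, where $\Delta f=-\sum_{x\in\Gamma}\big(\sum_{\vec v\text{ at }x}d_{\vec v}f(x)\big)\delta_x$ and $d_{\vec v}f(x)$ is the derivative of $f$ at $x$ in the direction $\vec v$ emanating from $x$. That is, $j_z(x,y)$ is the voltage at $x$ when unit current enters at $y$ and exits at $z$, with reference voltage $0$ at $z$, in $\Gamma$ viewed as a circuit with resistances equal to lengths. The resistance function is $r(x,y)=j_x(y,y)$. Let $\mu_{can}$ be the unique finite signed Borel measure $\mu$ on $\Gamma$ with $\mu(\Gamma)=1$ such that $j_\mu(x,x)=\int_\Gamma j_\zeta(x,x)\,d\mu(\zeta)$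 is independent of $x\in\Gamma$. The tau constant is $\tau(\Gamma)=\frac12 j_{\mu_{can}}(x,x)$. Theorem. For any points $p,q$ of $\Gamma$, the function $x\mapsto j_x(p,q)$ is differentiable at all interior points of edges with finitely many exceptions, the square of its derivative is integrable on $\Gamma$, and $$\tau(\Gamma)=\frac14\int_\Gamma\Big(\frac{d}{dx}j_x(p,q)\Big)^2dx+\frac14 r(p,q).$$ In particular (the case $q=p$), for any $p\in\Gamma$ the same regularity holds for $x\mapsto r(x,p)$, and $$\tau(\Gamma)=\frac14\int_\Gamma\Big(\frac{d}{dx}r(x,p)\Big)^2dx.$$ -/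

import Mathlib

open MeasureTheory Topology

/-- A metrized graph, given by a (non-empty) vertex set `V`, an edge set `E` and a parametrization
of each edge `e` by the segment `[0, len e]`, running from `src e` to `tgt e`. Self-loops, multiple
edges and vertices of any valence are allowed. Finiteness of `V` and `E` is assumed through type
classes where it is used. -/
structure MetrizedGraph (V E : Type*) where
  src : E → V
  tgt : E → V
  len : E → ℝ
  len_pos : ∀ e, 0 < len e
  nonempty : Nonempty V
  connected : ∀ u v : V, Relation.EqvGen (fun a b => ∃ e, src e = a ∧ tgt e = b) u v

namespace MetrizedGraph

variable {V E : Type*}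

/-- The points of the metrized graph: the vertices, and the interior points of the edges. This is
the disjoint union of `V` and the segments `[0, len e]`, with `0` and `len e` on the edge `e`
identified with the vertices `src e` and `tgt e`. -/
inductive Point (Γ : MetrizedGraph V E)
  | vertex (v : V) : Point Γ
  | interior (e : E) (t : ℝ) (ht : 0 < t ∧ t < Γ.len e) : Point Γ

open Classical in
/-- The parametrization of the edge `e` by `[0, len e]`. Outside of that segment it is extended by
its end values. -/
noncomputable def pt (Γ : MetrizedGraph V E) (e : E) (t : ℝ) : Γ.Point :=
  if ht : 0 < t ∧ t < Γ.len e then .interior e t ht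
  else if t ≤ 0 then .vertex (Γ.src e) else .vertex (Γ.tgt e)

/-- The quotient topology: a set is open if and only if its preimage under the parametrization of
every edge is open. -/
noncomputable instance instTopologicalSpacePoint (Γ : MetrizedGraph V E) : TopologicalSpace Γ.Point :=
  ⨆ e : E, TopologicalSpace.coinduced (Γ.pt e) inferInstance

noncomputable instance instMeasurableSpacePoint (Γ : MetrizedGraph V E) : MeasurableSpace Γ.Point :=
  borel Γ.Point

instance instBorelSpacePoint (Γ : MetrizedGraph V E) : BorelSpace Γ.Point := ⟨rfl⟩

/-- `f` is continuous, and affine near every interior point of an edge outside of a finite set. -/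
def IsPiecewiseAffine (Γ : MetrizedGraph V E) (f : Γ.Point → ℝ) : Prop :=
  Continuous f ∧ ∃ S : Set Γ.Point, S.Finite ∧ ∀ (e : E) (t : ℝ), 0 < t → t < Γ.len e →
    Γ.pt e t ∉ S → ∃ a b : ℝ, ∀ᶠ s in 𝓝 t, f (Γ.pt e s) = a * s + b

open Classical in
/-- The sum of the derivatives of `f` at the point `x` in all the directions emanating from `x`.
A self-loop at a vertex contributes two directions. -/
noncomputable def slopeSum (Γ : MetrizedGraph V E) [Fintype E] (f : Γ.Point → ℝ) : Γ.Point → ℝ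
  | .vertex v =>
      ∑ e : E, ((if Γ.src e = v then derivWithin (fun t => f (Γ.pt e t)) (Set.Ici 0) 0 else 0) -
        (if Γ.tgt e = v then
          derivWithin (fun t => f (Γ.pt e t)) (Set.Iic (Γ.len e)) (Γ.len e) else 0))
  | .interior e t _ =>
      derivWithin (fun s => f (Γ.pt e s)) (Set.Ici t) t -
        derivWithin (fun s => f (Γ.pt e s)) (Set.Iic t) t

open Classical in
/-- `f` is the voltage on `Γ`, seen as a resistive electric circuit in which resistance equals
length, when unit current enters at `y` and exits at `z`, with reference voltage `0` at `z`.
Equivalently `f` is continuous and piecewise affine with `Δ f = δ_y - δ_z` and `f z = 0`, where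
`Δ f = - ∑ x, slopeSum f x • δ_x` is the Laplacian of a piecewise affine function. -/
def IsVoltage (Γ : MetrizedGraph V E) [Fintype E] (z y : Γ.Point) (f : Γ.Point → ℝ) : Prop :=
  Γ.IsPiecewiseAffine f ∧ f z = 0 ∧
    ∀ x, -Γ.slopeSum f x = (if x = y then 1 else 0) - (if x = z then 1 else 0)

open Classical in
/-- The voltage function `j_z(x, y)`: the voltage at `x` when unit current enters at `y` and exits
at `z`, with reference voltage `0` at `z`. -/
noncomputable def voltage (Γ : MetrizedGraph V E) [Fintype E] (z x y : Γ.Point) : ℝ :=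
  if h : ∃ f, Γ.IsVoltage z y f then h.choose x else 0

/-- The resistance function `r(x, y) = j_x(y, y)`: the voltage difference between `y` and `x` when
unit current enters at `y` and exits at `x`. -/
noncomputable def resistance (Γ : MetrizedGraph V E) [Fintype E] (x y : Γ.Point) : ℝ :=
  Γ.voltage x y y

/-- `j_μ(x, y) = ∫ j_ζ(x, y) dμ(ζ)` for a finite signed Borel measure `μ` on `Γ`. -/
noncomputable def measureVoltage (Γ : MetrizedGraph V E) [Fintype E] (μ : SignedMeasure Γ.Point)
    (x y : Γ.Point) : ℝ :=
  ∫ᵛ ζ, Γ.voltage ζ x y ∂•μ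

/-- `μ` has total mass `1` and `j_μ(x, x)` does not depend on `x`. -/
def IsCanonicalMeasure (Γ : MetrizedGraph V E) [Fintype E] (μ : SignedMeasure Γ.Point) : Prop :=
  μ Set.univ = 1 ∧ ∀ x y, Γ.measureVoltage μ x x = Γ.measureVoltage μ y y

open Classical in
/-- The canonical measure of `Γ`. -/
noncomputable def canonicalMeasure (Γ : MetrizedGraph V E) [Fintype E] : SignedMeasure Γ.Point :=
  if h : ∃ μ, Γ.IsCanonicalMeasure μ then h.choose else 0

/-- The tau constant: half of the constant value of `j_μ(x, x)`, for the canonical measure `μ`. -/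
noncomputable def tau (Γ : MetrizedGraph V E) [Fintype E] : ℝ :=
  1 / 2 * Γ.measureVoltage Γ.canonicalMeasure (.vertex Γ.nonempty.some) (.vertex Γ.nonempty.some)

/-- `∫_Γ (d/dx g(x))² dx`: the sum of the integrals over the edges, each with respect to its
parametrization. -/
noncomputable def derivSqIntegral (Γ : MetrizedGraph V E) [Fintype E] (g : Γ.Point → ℝ) : ℝ :=
  ∑ e : E, ∫ t in (0 : ℝ)..Γ.len e, (deriv (fun s => g (Γ.pt e s)) t) ^ 2

/-- `d/dx g(x)` exists at all interior points `x` of edges with finitely many exceptions, and its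
square is integrable on `Γ`. -/
def HasDerivSqIntegral (Γ : MetrizedGraph V E) (g : Γ.Point → ℝ) : Prop :=
  (∃ S : Set Γ.Point, S.Finite ∧ ∀ (e : E) (t : ℝ), 0 < t → t < Γ.len e → Γ.pt e t ∉ S →
    DifferentiableAt ℝ (fun s => g (Γ.pt e s)) t) ∧
  ∀ e : E, IntervalIntegrable (fun t => (deriv (fun s => g (Γ.pt e s)) t) ^ 2) volume 0 (Γ.len e)

end MetrizedGraph

/-! Everything is expressed through one Green kernel `g` on Γ. Write `g_x` for `g(x, ·)`, `d(x) =
g(x, x)`, and `⟨f, h⟩ = ∫ f' h' dx`. Fix a vertex `o`. The kernel is symmetric, satisfies `Δ g_x =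
δ_x - δ_o` and `g(x, o) = 1`, and reproduces values: `⟨f, g_x⟩ = f(x) - f(o)`. On vertices it
inverts a positive definite form (`exists_isGreen`). On Γ it is the bilinear interpolation of the
vertex kernel plus the Dirichlet Green function of each edge.

Since piecewise affine functions with zero Laplacian are constant, voltages are explicit
(`IsGreen.voltage_eq`), and `j_x(p, q) = d(x) - g_p(x) - g_q(x) + g(p, q)`. Expanding the square of
the Dirichlet norm with the reproducing property gives `⟨d, d⟩ - (d(p) + d(q) - 2 g(p, q)) = ⟨d, d⟩
- r(p, q)`. So the integral plus `r(p, q)` is `⟨d, d⟩`, whatever `p` and `q` are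
(`IsGreen.derivSqIntegral_voltage`).

It remains to see that `τ = ⟨d, d⟩ / 4`. The functional `Λ f = f(o) + ⟨d, f⟩ / 2` is integration
against `δ_o + Δd / 2`, of mass 1. The reproducing property gives `Λ(r(x, ·)) = ⟨d, d⟩ / 2` for
every `x`, so this measure is canonical. For any other canonical `μ`, applying `Λ` in one variable
of `r` and `μ` in the other, in both orders, shows that the constant of `μ` is the same
(`IsGreen.measureVoltage_eq`). Uniqueness of the measure itself is not needed. -/

namespace MetrizedGraph

variable {V E : Type*}

/-! ### The energy form and the Green function on the vertices -/

/-- The Dirichlet form of the network with conductances `1 / len e`. -/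
noncomputable def energy (Γ : MetrizedGraph V E) [Fintype E] (u w : V → ℝ) : ℝ :=
  ∑ e, (u (Γ.tgt e) - u (Γ.src e)) * (w (Γ.tgt e) - w (Γ.src e)) / Γ.len e

section Energy

variable (Γ : MetrizedGraph V E) [Fintype E]

lemma energy_comm (u w : V → ℝ) : Γ.energy u w = Γ.energy w u :=
  Finset.sum_congr rfl fun _ _ => by ring

lemma energy_add_left (u u' w : V → ℝ) :
    Γ.energy (u + u') w = Γ.energy u w + Γ.energy u' w := by
  simp only [energy, ← Finset.sum_add_distrib, Pi.add_apply]
  exact Finset.sum_congr rfl fun _ _ => by ring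

lemma energy_smul_left (c : ℝ) (u w : V → ℝ) : Γ.energy (c • u) w = c * Γ.energy u w := by
  simp only [energy, Finset.mul_sum, Pi.smul_apply, smul_eq_mul]
  exact Finset.sum_congr rfl fun _ _ => by ring

lemma energy_self_nonneg (u : V → ℝ) : 0 ≤ Γ.energy u u :=
  Finset.sum_nonneg fun e _ => div_nonneg (mul_self_nonneg _) (Γ.len_pos e).le

variable {Γ} in
-- Each summand is nonnegative, so zero energy forces equal values at the ends of every edge;
-- connectedness spreads the equality.
lemma eq_of_energy_self_eq_zero {u : V → ℝ} (h : Γ.energy u u = 0) (v w : V) : u v = u w := by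
  have he : ∀ e, u (Γ.tgt e) = u (Γ.src e) := by
    intro e
    have := (Finset.sum_eq_zero_iff_of_nonneg fun e _ =>
      div_nonneg (mul_self_nonneg _) (Γ.len_pos e).le).1 h e (Finset.mem_univ e)
    rcases div_eq_zero_iff.1 this with h | h
    · linarith [mul_self_eq_zero.1 h]
    · exact absurd h (Γ.len_pos e).ne'
  induction Γ.connected v w with
  | rel a b hab => obtain ⟨e, rfl, rfl⟩ := hab; exact (he e).symm
  | refl => rfl
  | symm a b _ ih => exact ih.symm
  | trans a b c _ _ h₁ h₂ => exact h₁.trans h₂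

/-- `G v` is the voltage on the vertices when unit current enters at `v` and exits at `o`,
normalized by `G v o = 1`. -/
structure IsGreen (o : V) (G : V → V → ℝ) : Prop where
  symm : ∀ v w, G v w = G w v
  base : ∀ v, G v o = 1
  energy : ∀ v u, Γ.energy (G v) u = u v - u o

/-- The constants are the kernel of the energy, so adding `u o * w o` makes the form positive
definite, hence invertible in finite dimension. `G v` is the vector representing evaluation at `v`.
-/
theorem exists_isGreen [Finite V] : ∃ o G, Γ.IsGreen o G := by
  obtain ⟨o⟩ := Γ.nonempty
  let B : (V → ℝ) →ₗ[ℝ] (V → ℝ) →ₗ[ℝ] ℝ :=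
    LinearMap.mk₂ ℝ (fun u w => Γ.energy u w + u o * w o)
      (fun u u' w => by simp only [energy_add_left, Pi.add_apply]; ring)
      (fun c u w => by simp only [energy_smul_left, Pi.smul_apply, smul_eq_mul]; ring)
      (fun u w w' => by
        simp only [energy_comm Γ u, energy_add_left, Pi.add_apply]; ring)
      (fun c u w => by
        simp only [energy_comm Γ u, energy_smul_left, Pi.smul_apply, smul_eq_mul]; ring)
  have hB : ∀ u w, B u w = Γ.energy u w + u o * w o := fun u w => rfl
  have hinj : Function.Injective B := by
    rw [injective_iff_map_eq_zero]
    intro u hu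
    have h0 : Γ.energy u u + u o * u o = 0 := by rw [← hB, hu]; rfl
    have h1 := Γ.energy_self_nonneg u
    have h2 := mul_self_nonneg (u o)
    have h3 : u o = 0 := mul_self_eq_zero.1 (by linarith)
    funext v
    rw [eq_of_energy_self_eq_zero (by linarith : Γ.energy u u = 0) v o, h3]; rfl
  have hsurj : Function.Surjective B :=
    (LinearMap.injective_iff_surjective_of_finrank_eq_finrank
      Subspace.dual_finrank_eq.symm).1 hinj
  choose G hG using fun v : V => hsurj (LinearMap.proj v)
  have hG' : ∀ v w, Γ.energy (G v) w + G v o * w o = w v := fun v w => by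
    rw [← hB, hG]; rfl
  -- The constant function 1 has no energy, so testing against it leaves only the added term.
  have hbase : ∀ v, G v o = 1 := fun v => by
    simpa [energy] using hG' v (fun _ => 1)
  refine ⟨o, G, fun v w => ?_, hbase, fun v u => ?_⟩
  · have h1 := hG' v (G w)
    have h2 := hG' w (G v)
    rw [energy_comm] at h2
    linarith
  · have := hG' v u
    rw [hbase] at this
    linarith

end Energy

/-! ### Points and the parametrizations of the edges -/

section Points

variable (Γ : MetrizedGraph V E)

lemma pt_of_mem {e : E} {t : ℝ} (ht : 0 < t ∧ t < Γ.len e) : Γ.pt e t = .interior e t ht := by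
  simp [pt, ht]

lemma pt_of_le {e : E} {t : ℝ} (ht : t ≤ 0) : Γ.pt e t = .vertex (Γ.src e) := by
  simp [pt, ht, not_lt.2 ht]

lemma pt_of_ge {e : E} {t : ℝ} (ht : Γ.len e ≤ t) : Γ.pt e t = .vertex (Γ.tgt e) := by
  simp [pt, not_lt.2 ht, (Γ.len_pos e).trans_le ht]

lemma pt_zero (e : E) : Γ.pt e 0 = .vertex (Γ.src e) := Γ.pt_of_le le_rfl

lemma pt_len (e : E) : Γ.pt e (Γ.len e) = .vertex (Γ.tgt e) := Γ.pt_of_ge le_rfl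

lemma pt_clamp (e : E) (t : ℝ) : Γ.pt e (max 0 (min t (Γ.len e))) = Γ.pt e t := by
  have hL := Γ.len_pos e
  rcases le_total t 0 with h | h
  · rw [min_eq_left (h.trans hL.le), max_eq_left h, Γ.pt_of_le h, Γ.pt_zero]
  rcases le_total t (Γ.len e) with h' | h'
  · rw [min_eq_left h', max_eq_right h]
  · rw [min_eq_right h', max_eq_right hL.le, Γ.pt_of_ge h', Γ.pt_len]

lemma clamp_mem (e : E) (t : ℝ) : max 0 (min t (Γ.len e)) ∈ Set.Icc 0 (Γ.len e) :=
  ⟨le_max_left _ _, max_le (Γ.len_pos e).le (min_le_right _ _)⟩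

lemma continuous_pt (e : E) : Continuous (Γ.pt e) :=
  continuous_iff_coinduced_le.2 (le_iSup (fun e => TopologicalSpace.coinduced (Γ.pt e) _) e)

/-- A function on `Γ` is continuous if its restriction to every edge is. -/
lemma continuous_of_continuousOn {f : Γ.Point → ℝ}
    (h : ∀ e, ContinuousOn (fun s => f (Γ.pt e s)) (Set.Icc 0 (Γ.len e))) : Continuous f := by
  refine continuous_iSup_dom.2 fun e => continuous_coinduced_dom.2 ?_
  have : f ∘ Γ.pt e = fun t => f (Γ.pt e (max 0 (min t (Γ.len e)))) := by
    funext t; simp [pt_clamp]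
  rw [this]
  exact (h e).comp_continuous (by fun_prop) fun t => Γ.clamp_mem e t

lemma finite_pt_mem {S : Set Γ.Point} (hS : S.Finite) (e : E) :
    {t | t ∈ Set.Ioo 0 (Γ.len e) ∧ Γ.pt e t ∈ S}.Finite := by
  refine Set.Finite.of_finite_image (f := Γ.pt e) (hS.subset ?_) ?_
  · rintro _ ⟨t, ht, rfl⟩; exact ht.2
  · intro s hs t ht hst
    rw [Γ.pt_of_mem hs.1, Γ.pt_of_mem ht.1] at hst
    exact (Point.interior.inj hst).2

/-- The barycentric interpolation of a function on the vertices, affine on every edge. -/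
noncomputable def interp (w : V → ℝ) : Γ.Point → ℝ
  | .vertex v => w v
  | .interior e t _ => (1 - t / Γ.len e) * w (Γ.src e) + t / Γ.len e * w (Γ.tgt e)

lemma interp_pt (w : V → ℝ) {e : E} {s : ℝ} (hs : s ∈ Set.Icc 0 (Γ.len e)) :
    Γ.interp w (Γ.pt e s) = w (Γ.src e) + (w (Γ.tgt e) - w (Γ.src e)) / Γ.len e * s := by
  have hL := Γ.len_pos e
  rcases hs.1.eq_or_lt with rfl | h0
  · simp [pt_zero, interp]
  rcases hs.2.eq_or_lt with rfl | h1
  · rw [pt_len]; simp only [interp]; field_simp; ring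
  · rw [Γ.pt_of_mem ⟨h0, h1⟩]; simp only [interp]; field_simp; ring

lemma interp_const (c : ℝ) (x : Γ.Point) : Γ.interp (fun _ => c) x = c := by
  cases x <;> simp [interp]; ring

open Classical in
/-- The Green function with Dirichlet boundary conditions of the edges, as a function of the
parameter `s` on the edge `e`. -/
noncomputable def edgeGreen : Γ.Point → E → ℝ → ℝ
  | .vertex _, _, _ => 0
  | .interior e t _, e', s => if e = e' then min s t * (Γ.len e - max s t) / Γ.len e else 0

/-- The Green kernel on `Γ`, built from a Green kernel on the vertices. -/
noncomputable def green (G : V → V → ℝ) (x : Γ.Point) : Γ.Point → ℝ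
  | .vertex v => Γ.interp (G v) x
  | .interior e s h =>
      Γ.interp (fun w => Γ.interp (G w) x) (.interior e s h) + Γ.edgeGreen x e s

/-- The edge Green function vanishes at both ends, so the interior formula persists on the closed
edge. -/
lemma green_pt (G : V → V → ℝ) (x : Γ.Point) {e : E} {s : ℝ} (hs : s ∈ Set.Icc 0 (Γ.len e)) :
    Γ.green G x (Γ.pt e s) =
      Γ.interp (fun w => Γ.interp (G w) x) (Γ.pt e s) + Γ.edgeGreen x e s := by
  rcases hs.1.eq_or_lt with rfl | h0
  · rw [pt_zero]
    rcases x with v | ⟨e', t, ht⟩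
    · simp [green, interp, edgeGreen]
    · simp [green, interp, edgeGreen, min_eq_left ht.1.le]
  rcases hs.2.eq_or_lt with h | h1
  · rw [Γ.pt_of_ge h.ge]
    rcases x with v | ⟨e', t, ht⟩
    · simp [green, interp, edgeGreen]
    · by_cases he : e' = e
      · subst he
        simp [green, interp, edgeGreen, h, max_eq_left ht.2.le]
      · simp [green, interp, edgeGreen, he]
  · rw [Γ.pt_of_mem ⟨h0, h1⟩]; rfl

lemma green_comm {G : V → V → ℝ} (hG : ∀ v w, G v w = G w v) (x y : Γ.Point) :
    Γ.green G x y = Γ.green G y x := by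
  rcases x with v | ⟨e, t, ht⟩ <;> rcases y with w | ⟨e', s, hs⟩
  · simp [green, interp, hG v w]
  · simp [green, interp, edgeGreen, hG v]
  · simp [green, interp, edgeGreen, hG w]
  · have h : Γ.edgeGreen (.interior e t ht) e' s = Γ.edgeGreen (.interior e' s hs) e t := by
      by_cases he : e = e'
      · subst he; simp [edgeGreen, min_comm, max_comm]
      · simp [edgeGreen, he, Ne.symm he]
    simp only [green, interp, h, hG (Γ.src e') (Γ.src e), hG (Γ.src e') (Γ.tgt e),
      hG (Γ.tgt e') (Γ.src e), hG (Γ.tgt e') (Γ.tgt e)]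
    ring

lemma continuous_edgeGreen (x : Γ.Point) (e : E) : Continuous (Γ.edgeGreen x e) := by
  rcases x with v | ⟨e', t, ht⟩
  · exact continuous_const
  · by_cases he : e' = e
    · have : Γ.edgeGreen (.interior e' t ht) e =
          fun s => min s t * (Γ.len e' - max s t) / Γ.len e' := by
        funext s; simp [edgeGreen, he]
      rw [this]; fun_prop
    · have : Γ.edgeGreen (.interior e' t ht) e = fun _ => 0 := by
        funext s; simp [edgeGreen, he]
      rw [this]; fun_prop

lemma continuous_interp (w : V → ℝ) : Continuous (Γ.interp w) := by
  refine Γ.continuous_of_continuousOn fun e => ?_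
  refine ContinuousOn.congr (f := fun s => w (Γ.src e) +
    (w (Γ.tgt e) - w (Γ.src e)) / Γ.len e * s) (by fun_prop) fun s hs => Γ.interp_pt w hs

lemma continuous_green (G : V → V → ℝ) (x : Γ.Point) : Continuous (Γ.green G x) := by
  refine Γ.continuous_of_continuousOn fun e => ?_
  refine ContinuousOn.congr (f := fun s => Γ.interp (fun w => Γ.interp (G w) x) (Γ.pt e s) +
    Γ.edgeGreen x e s) ?_ fun s hs => Γ.green_pt G x hs
  exact (((Γ.continuous_interp _).comp (Γ.continuous_pt e)).add
    (Γ.continuous_edgeGreen x e)).continuousOn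

/-- The coefficient of the quadratic term of the diagonal of the Green kernel on an edge. -/
noncomputable def diagCoeff (G : V → V → ℝ) (e : E) : ℝ :=
  1 / Γ.len e - (G (Γ.src e) (Γ.src e) + G (Γ.tgt e) (Γ.tgt e) - 2 * G (Γ.src e) (Γ.tgt e)) /
    Γ.len e ^ 2

/-- Bilinear interpolation restricted to the diagonal is quadratic, and `s * (L - s) / L` comes from
the edge Green function. The coefficient is `(1 - R / L) / L`, with `R` the effective resistance
between the ends of `e`. -/
lemma green_diag_pt {G : V → V → ℝ} (hG : ∀ v w, G v w = G w v) {e : E} {s : ℝ}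
    (hs : s ∈ Set.Icc 0 (Γ.len e)) :
    Γ.green G (Γ.pt e s) (Γ.pt e s) = G (Γ.src e) (Γ.src e) +
      (G (Γ.tgt e) (Γ.tgt e) - G (Γ.src e) (Γ.src e)) / Γ.len e * s +
      Γ.diagCoeff G e * (s * (Γ.len e - s)) := by
  have hL := (Γ.len_pos e).ne'
  have hk : Γ.edgeGreen (Γ.pt e s) e s = s * (Γ.len e - s) / Γ.len e := by
    rcases hs.1.eq_or_lt with rfl | h0
    · simp [pt_zero, edgeGreen]
    rcases hs.2.eq_or_lt with rfl | h1
    · simp [pt_len, edgeGreen]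
    · simp [Γ.pt_of_mem ⟨h0, h1⟩, edgeGreen]
  rw [Γ.green_pt G _ hs, hk]
  simp only [Γ.interp_pt _ hs, diagCoeff]
  rw [hG (Γ.tgt e) (Γ.src e)]
  field_simp
  ring

end Points

/-! ### Piecewise affine functions of one variable -/

/-- The derivative is locally constant on a connected interval, hence constant; the mean value
theorem and continuity reach the endpoints. -/
lemma exists_slope_of_locally_affine {φ : ℝ → ℝ} {a b : ℝ} (hab : a < b) (hc : Continuous φ)
    (h : ∀ t ∈ Set.Ioo a b, ∃ m c : ℝ, ∀ᶠ s in 𝓝 t, φ s = m * s + c) :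
    ∃ m, ∀ s ∈ Set.Icc a b, φ s = φ a + m * (s - a) := by
  have h1 : ∀ t ∈ Set.Ioo a b, ∃ m, HasDerivAt φ m t ∧ deriv φ =ᶠ[𝓝 t] fun _ => m := by
    intro t ht
    obtain ⟨m, c, hmc⟩ := h t ht
    have hd : ∀ s, HasDerivAt (fun s => m * s + c) m s := fun s => by
      simpa using ((hasDerivAt_id s).const_mul m).add_const c
    have hmc' : φ =ᶠ[𝓝 t] fun s => m * s + c := hmc
    refine ⟨m, (hd t).congr_of_eventuallyEq hmc', hmc'.deriv.trans ?_⟩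
    exact Filter.Eventually.of_forall fun s => (hd s).deriv
  have hmid : (a + b) / 2 ∈ Set.Ioo a b := ⟨by linarith, by linarith⟩
  have h2 : ∀ t ∈ Set.Ioo a b, deriv φ t = deriv φ ((a + b) / 2) := by
    intro t ht
    refine isOpen_Ioo.is_const_of_deriv_eq_zero isPreconnected_Ioo ?_ ?_ ht hmid
    · intro s hs
      obtain ⟨m, -, hm⟩ := h1 s hs
      exact ((differentiableAt_const m).congr_of_eventuallyEq hm).differentiableWithinAt
    · intro s hs
      obtain ⟨m, -, hm⟩ := h1 s hs
      simp [hm.deriv_eq]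
  refine ⟨deriv φ ((a + b) / 2), fun s hs => ?_⟩
  rcases hs.1.eq_or_lt with rfl | has
  · simp
  obtain ⟨c, hcm, hcd⟩ := exists_deriv_eq_slope φ has hc.continuousOn fun t ht => by
    obtain ⟨m, hm, -⟩ := h1 t ⟨ht.1, ht.2.trans_le hs.2⟩
    exact hm.differentiableAt.differentiableWithinAt
  rw [h2 c ⟨hcm.1, hcm.2.trans_le hs.2⟩, eq_div_iff (by linarith)] at hcd
  linarith

lemma exists_right_slope {φ : ℝ → ℝ} {L : ℝ} {S : Set ℝ} (hc : Continuous φ) (hS : S.Finite)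
    (h : ∀ t ∈ Set.Ioo 0 L, t ∉ S → ∃ m c : ℝ, ∀ᶠ s in 𝓝 t, φ s = m * s + c)
    {t : ℝ} (ht : t ∈ Set.Ico 0 L) : ∃ m, ∀ᶠ s in 𝓝[≥] t, φ s = φ t + m * (s - t) := by
  -- The point `t` may itself be exceptional; only the other exceptional points must be avoided.
  have hn : (S \ {t})ᶜ ∈ 𝓝 t := (hS.subset Set.sdiff_subset).isClosed.isOpen_compl.mem_nhds (by simp)
  obtain ⟨u, hu, hu'⟩ := mem_nhdsGT_iff_exists_Ioo_subset.1 (mem_nhdsWithin_of_mem_nhds hn)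
  have hlt : t < min u L := lt_min hu ht.2
  obtain ⟨m, hm⟩ := exists_slope_of_locally_affine hlt hc fun s hs =>
    h s ⟨ht.1.trans_lt hs.1, hs.2.trans_le (min_le_right _ _)⟩ fun hsS =>
      hu' ⟨hs.1, hs.2.trans_le (min_le_left _ _)⟩ ⟨hsS, hs.1.ne'⟩
  exact ⟨m, Filter.mem_of_superset (Icc_mem_nhdsGE hlt) hm⟩

lemma exists_left_slope {φ : ℝ → ℝ} {L : ℝ} {S : Set ℝ} (hc : Continuous φ) (hS : S.Finite)
    (h : ∀ t ∈ Set.Ioo 0 L, t ∉ S → ∃ m c : ℝ, ∀ᶠ s in 𝓝 t, φ s = m * s + c)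
    {t : ℝ} (ht : t ∈ Set.Ioc 0 L) : ∃ m, ∀ᶠ s in 𝓝[≤] t, φ s = φ t + m * (s - t) := by
  -- The reflection `s ↦ L - s` turns left slopes into right slopes.
  obtain ⟨m, hm⟩ := exists_right_slope (φ := fun s => φ (L - s)) (L := L)
    (S := (fun s => L - s) ⁻¹' S) (t := L - t) (by fun_prop)
    (hS.preimage (sub_right_injective.injOn)) (fun s hs hsS => by
      obtain ⟨m, c, hmc⟩ := h (L - s) ⟨by linarith [hs.2], by linarith [hs.1]⟩ hsS
      refine ⟨-m, m * L + c, ?_⟩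
      have : Filter.Tendsto (fun s => L - s) (𝓝 s) (𝓝 (L - s)) :=
        (continuous_const.sub continuous_id).tendsto s
      filter_upwards [this.eventually hmc] with r hr
      rw [hr]; ring) ⟨by linarith [ht.2], by linarith [ht.1]⟩
  refine ⟨-m, ?_⟩
  have : Filter.Tendsto (fun s => L - s) (𝓝[≤] t) (𝓝[≥] (L - t)) :=
    tendsto_nhdsWithin_of_tendsto_nhds_of_eventually_within _
      (((continuous_const.sub continuous_id).tendsto t).mono_left nhdsWithin_le_nhds)
      (Filter.mem_of_superset self_mem_nhdsWithin fun s hs => by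
        simp only [Set.mem_Iic, Set.mem_Ici, Set.mem_ofPred_eq] at *; linarith)
  filter_upwards [this.eventually hm] with s hs
  simp only [sub_sub_cancel] at hs
  rw [hs]; ring

lemma hasDerivWithinAt_of_eventually_affine {φ : ℝ → ℝ} {s : Set ℝ} {t m : ℝ}
    (h : ∀ᶠ r in 𝓝[s] t, φ r = φ t + m * (r - t)) : HasDerivWithinAt φ m s t := by
  have hd : HasDerivAt (fun r => φ t + m * (r - t)) m t := by
    simpa using (((hasDerivAt_id t).sub_const t).const_mul m).const_add (φ t)
  exact hd.hasDerivWithinAt.congr_of_eventuallyEq h (by simp)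

/-! ### One-sided slopes and uniqueness of voltage functions -/

section Slopes

variable (Γ : MetrizedGraph V E)

/-- `f` has one-sided derivatives at all points of the closed edges. -/
def HasSlopes (f : Γ.Point → ℝ) : Prop :=
  ∀ e : E, (∀ s ∈ Set.Ico 0 (Γ.len e),
      DifferentiableWithinAt ℝ (fun r => f (Γ.pt e r)) (Set.Ici s) s) ∧
    ∀ s ∈ Set.Ioc 0 (Γ.len e), DifferentiableWithinAt ℝ (fun r => f (Γ.pt e r)) (Set.Iic s) s

variable {Γ}

lemma IsPiecewiseAffine.exists_finite {f : Γ.Point → ℝ} (hf : Γ.IsPiecewiseAffine f) (e : E) :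
    ∃ S : Set ℝ, S.Finite ∧ ∀ t ∈ Set.Ioo 0 (Γ.len e), t ∉ S →
      ∃ m c : ℝ, ∀ᶠ s in 𝓝 t, f (Γ.pt e s) = m * s + c := by
  obtain ⟨-, S, hS, h⟩ := hf
  exact ⟨_, Γ.finite_pt_mem hS e, fun t ht htS => h e t ht.1 ht.2 fun hmem => htS ⟨ht, hmem⟩⟩

lemma IsPiecewiseAffine.continuous_edge {f : Γ.Point → ℝ} (hf : Γ.IsPiecewiseAffine f) (e : E) :
    Continuous fun s => f (Γ.pt e s) := hf.1.comp (Γ.continuous_pt e)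

lemma IsPiecewiseAffine.hasSlopes {f : Γ.Point → ℝ} (hf : Γ.IsPiecewiseAffine f) :
    Γ.HasSlopes f := by
  intro e
  obtain ⟨S, hS, h⟩ := hf.exists_finite e
  refine ⟨fun s hs => ?_, fun s hs => ?_⟩
  · obtain ⟨m, hm⟩ := exists_right_slope (hf.continuous_edge e) hS h hs
    exact (hasDerivWithinAt_of_eventually_affine hm).differentiableWithinAt
  · obtain ⟨m, hm⟩ := exists_left_slope (hf.continuous_edge e) hS h hs
    exact (hasDerivWithinAt_of_eventually_affine hm).differentiableWithinAt

lemma IsPiecewiseAffine.sub {f g : Γ.Point → ℝ} (hf : Γ.IsPiecewiseAffine f)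
    (hg : Γ.IsPiecewiseAffine g) : Γ.IsPiecewiseAffine fun x => f x - g x := by
  obtain ⟨hfc, S, hS, hfS⟩ := hf
  obtain ⟨hgc, T, hT, hgT⟩ := hg
  refine ⟨hfc.sub hgc, S ∪ T, hS.union hT, fun e t h0 h1 hST => ?_⟩
  obtain ⟨a, b, hab⟩ := hfS e t h0 h1 fun h => hST (.inl h)
  obtain ⟨a', b', hab'⟩ := hgT e t h0 h1 fun h => hST (.inr h)
  refine ⟨a - a', b - b', ?_⟩
  filter_upwards [hab, hab'] with s h h'
  rw [h, h']; ring

lemma isPiecewiseAffine_const (c : ℝ) : Γ.IsPiecewiseAffine fun _ => c :=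
  ⟨continuous_const, ∅, Set.finite_empty, fun _ _ _ _ _ => ⟨0, c, by simp⟩⟩

variable [Fintype E]

lemma slopeSum_sub {f g : Γ.Point → ℝ} (hf : Γ.HasSlopes f) (hg : Γ.HasSlopes g) (x : Γ.Point) :
    Γ.slopeSum (fun x => f x - g x) x = Γ.slopeSum f x - Γ.slopeSum g x := by
  have hr : ∀ e, ∀ s ∈ Set.Ico 0 (Γ.len e),
      derivWithin (fun r => f (Γ.pt e r) - g (Γ.pt e r)) (Set.Ici s) s =
      derivWithin (fun r => f (Γ.pt e r)) (Set.Ici s) s -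
        derivWithin (fun r => g (Γ.pt e r)) (Set.Ici s) s := fun e s hs =>
    derivWithin_fun_sub ((hf e).1 s hs) ((hg e).1 s hs)
  have hl : ∀ e, ∀ s ∈ Set.Ioc 0 (Γ.len e),
      derivWithin (fun r => f (Γ.pt e r) - g (Γ.pt e r)) (Set.Iic s) s =
      derivWithin (fun r => f (Γ.pt e r)) (Set.Iic s) s -
        derivWithin (fun r => g (Γ.pt e r)) (Set.Iic s) s := fun e s hs =>
    derivWithin_fun_sub ((hf e).2 s hs) ((hg e).2 s hs)
  rcases x with v | ⟨e, t, ht⟩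
  · simp only [slopeSum, ← Finset.sum_sub_distrib]
    refine Finset.sum_congr rfl fun e _ => ?_
    rw [hr e 0 ⟨le_rfl, Γ.len_pos e⟩, hl e (Γ.len e) ⟨Γ.len_pos e, le_rfl⟩]
    split_ifs <;> ring
  · simp only [slopeSum]
    rw [hr e t ⟨ht.1.le, ht.2⟩, hl e t ⟨ht.1, ht.2.le⟩]
    ring

lemma slopeSum_const (c : ℝ) (x : Γ.Point) : Γ.slopeSum (fun _ => c) x = 0 := by
  cases x <;> simp [slopeSum]

/-- A piecewise affine function with zero Laplacian is affine on the edges. -/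
lemma IsPiecewiseAffine.affine_of_slopeSum_eq_zero {f : Γ.Point → ℝ} (hf : Γ.IsPiecewiseAffine f)
    (h0 : ∀ x, Γ.slopeSum f x = 0) (e : E) {s : ℝ} (hs : s ∈ Set.Icc 0 (Γ.len e)) :
    f (Γ.pt e s) = f (.vertex (Γ.src e)) +
      (f (.vertex (Γ.tgt e)) - f (.vertex (Γ.src e))) / Γ.len e * s := by
  obtain ⟨S, hS, h⟩ := hf.exists_finite e
  have hL := Γ.len_pos e
  obtain ⟨m, hm⟩ := exists_slope_of_locally_affine hL (hf.continuous_edge e) fun t ht => by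
    obtain ⟨m, hm⟩ := exists_right_slope (hf.continuous_edge e) hS h ⟨ht.1.le, ht.2⟩
    obtain ⟨m', hm'⟩ := exists_left_slope (hf.continuous_edge e) hS h ⟨ht.1, ht.2.le⟩
    -- Zero Laplacian at an interior point makes the two one-sided slopes agree, so even the
    -- exceptional points are not corners.
    have hmm : m = m' := by
      have := h0 (.interior e t ht)
      simp only [slopeSum] at this
      rw [(hasDerivWithinAt_of_eventually_affine hm).derivWithin (uniqueDiffWithinAt_Ici t),
        (hasDerivWithinAt_of_eventually_affine hm').derivWithin (uniqueDiffWithinAt_Iic t)] at this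
      linarith
    subst hmm
    refine ⟨m, f (Γ.pt e t) - m * t, ?_⟩
    rw [← nhdsLE_sup_nhdsGE, Filter.eventually_sup]
    constructor
    · filter_upwards [hm'] with r hr
      rw [hr]; ring
    · filter_upwards [hm] with r hr
      rw [hr]; ring
  have h1 := hm (Γ.len e) ⟨hL.le, le_rfl⟩
  rw [hm s hs]
  simp only [pt_len, pt_zero] at h1 ⊢
  rw [h1]
  field_simp
  ring

/-- A piecewise affine function with zero Laplacian is constant. -/
theorem IsPiecewiseAffine.const_of_slopeSum_eq_zero [Finite V] {f : Γ.Point → ℝ}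
    (hf : Γ.IsPiecewiseAffine f) (h0 : ∀ x, Γ.slopeSum f x = 0) (x y : Γ.Point) : f x = f y := by
  classical
  cases nonempty_fintype V
  have haff := fun e s hs => hf.affine_of_slopeSum_eq_zero h0 e (s := s) hs
  set u : V → ℝ := fun v => f (.vertex v) with hu
  have hr : ∀ e, derivWithin (fun t => f (Γ.pt e t)) (Set.Ici 0) 0 =
      (u (Γ.tgt e) - u (Γ.src e)) / Γ.len e := fun e => by
    refine (hasDerivWithinAt_of_eventually_affine ?_).derivWithin (uniqueDiffWithinAt_Ici 0)
    filter_upwards [Icc_mem_nhdsGE (Γ.len_pos e)] with r hr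
    rw [haff e r hr]; simp [pt_zero, hu]
  have hl : ∀ e, derivWithin (fun t => f (Γ.pt e t)) (Set.Iic (Γ.len e)) (Γ.len e) =
      (u (Γ.tgt e) - u (Γ.src e)) / Γ.len e := fun e => by
    refine (hasDerivWithinAt_of_eventually_affine ?_).derivWithin (uniqueDiffWithinAt_Iic _)
    filter_upwards [Icc_mem_nhdsLE (Γ.len_pos e)] with r hr
    have := (Γ.len_pos e).ne'
    rw [haff e r hr, pt_len]; simp only [hu]; field_simp; ring
  -- Summation by parts: pairing the vertex slope sums with `u` gives minus the energy of `u`.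
  have hE : Γ.energy u u = 0 := by
    have h1 : ∀ v, u v * Γ.slopeSum f (.vertex v) = 0 := fun v => by rw [h0, mul_zero]
    have h2 : ∑ v, u v * Γ.slopeSum f (.vertex v) = 0 := Finset.sum_eq_zero fun v _ => h1 v
    simp only [slopeSum, hr, hl, Finset.mul_sum] at h2
    rw [Finset.sum_comm] at h2
    rw [← neg_eq_zero, ← h2, energy, ← Finset.sum_neg_distrib]
    refine Finset.sum_congr rfl fun e _ => ?_
    simp only [mul_sub, mul_ite, mul_zero, Finset.sum_sub_distrib, Finset.sum_ite_eq,
      Finset.mem_univ, if_true]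
    ring
  have hv := eq_of_energy_self_eq_zero hE
  have key : ∀ x : Γ.Point, ∀ v, f x = u v := by
    rintro (w | ⟨e, t, ht⟩) v
    · exact hv w v
    · rw [← Γ.pt_of_mem ht, haff e t ⟨ht.1.le, ht.2.le⟩]
      change u _ + (u _ - u _) / _ * _ = _
      rw [hv (Γ.tgt e) v, hv (Γ.src e) v]; ring
  obtain ⟨v⟩ := Γ.nonempty
  rw [key x v, key y v]

theorem IsVoltage.unique [Finite V] {z y : Γ.Point} {f g : Γ.Point → ℝ} (hf : Γ.IsVoltage z y f)
    (hg : Γ.IsVoltage z y g) : f = g := by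
  funext x
  have := (hf.1.sub hg.1).const_of_slopeSum_eq_zero (fun x => by
    rw [slopeSum_sub hf.1.hasSlopes hg.1.hasSlopes]
    linarith [hf.2.2 x, hg.2.2 x]) x z
  simp only [hf.2.1, hg.2.1] at this
  linarith

/-- `voltage` selects its function by choice; uniqueness lets any explicit solution replace it. -/
lemma voltage_eq_of_isVoltage [Finite V] {z y : Γ.Point} {f : Γ.Point → ℝ}
    (hf : Γ.IsVoltage z y f) (x : Γ.Point) : Γ.voltage z x y = f x := by
  have h : ∃ f, Γ.IsVoltage z y f := ⟨f, hf⟩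
  rw [voltage, dif_pos h, h.choose_spec.unique hf]

end Slopes

/-! ### The Green kernel as a voltage -/

section Tent

variable {L t : ℝ}

lemma hasDerivAt_tent_of_lt {s : ℝ} (h : s < t) :
    HasDerivAt (fun s => min s t * (L - max s t) / L) ((L - t) / L) s := by
  have hd : HasDerivAt (fun s => s * (L - t) / L) ((L - t) / L) s := by
    simpa using ((hasDerivAt_id s).mul_const (L - t)).div_const L
  refine hd.congr_of_eventuallyEq ?_
  filter_upwards [Iio_mem_nhds h] with r hr
  rw [min_eq_left (le_of_lt hr), max_eq_right (le_of_lt hr)]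

lemma hasDerivAt_tent_of_gt {s : ℝ} (h : t < s) :
    HasDerivAt (fun s => min s t * (L - max s t) / L) (-t / L) s := by
  have hd : HasDerivAt (fun s => t * (L - s) / L) (-t / L) s := by
    simpa using (((hasDerivAt_id s).const_sub L).const_mul t).div_const L
  refine hd.congr_of_eventuallyEq ?_
  filter_upwards [Ioi_mem_nhds h] with r hr
  rw [min_eq_right (le_of_lt hr), max_eq_left (le_of_lt hr)]

/-- At the kink `s = t` this side takes the value `-t / L`, while the left derivative is `(L - t) /
L`. The drop by 1 is the unit source. -/
lemma hasDerivWithinAt_tent_Ici (s : ℝ) :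
    HasDerivWithinAt (fun s => min s t * (L - max s t) / L)
      (if s < t then (L - t) / L else -t / L) (Set.Ici s) s := by
  split_ifs with h
  · exact (hasDerivAt_tent_of_lt h).hasDerivWithinAt
  · have hd : HasDerivAt (fun s => t * (L - s) / L) (-t / L) s := by
      simpa using (((hasDerivAt_id s).const_sub L).const_mul t).div_const L
    have hr : ∀ r ∈ Set.Ici s, min r t * (L - max r t) / L = t * (L - r) / L := fun r hr => by
      rw [min_eq_right ((not_lt.1 h).trans hr), max_eq_left ((not_lt.1 h).trans hr)]
    exact hd.hasDerivWithinAt.congr hr (hr s Set.self_mem_Ici)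

lemma hasDerivWithinAt_tent_Iic (s : ℝ) :
    HasDerivWithinAt (fun s => min s t * (L - max s t) / L)
      (if s ≤ t then (L - t) / L else -t / L) (Set.Iic s) s := by
  split_ifs with h
  · have hd : HasDerivAt (fun s => s * (L - t) / L) ((L - t) / L) s := by
      simpa using ((hasDerivAt_id s).mul_const (L - t)).div_const L
    have hr : ∀ r ∈ Set.Iic s, min r t * (L - max r t) / L = r * (L - t) / L := fun r hr => by
      rw [min_eq_left (le_trans hr h), max_eq_right (le_trans hr h)]
    exact hd.hasDerivWithinAt.congr hr (hr s Set.self_mem_Iic)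
  · exact (hasDerivAt_tent_of_gt (not_le.1 h)).hasDerivWithinAt

end Tent

section Green

variable (Γ : MetrizedGraph V E)

open Classical in
/-- The right derivative of `edgeGreen`. -/
noncomputable def edgeGreenRight : Γ.Point → E → ℝ → ℝ
  | .vertex _, _, _ => 0
  | .interior e t _, e', s =>
      if e = e' then (if s < t then (Γ.len e - t) / Γ.len e else -t / Γ.len e) else 0

open Classical in
/-- The left derivative of `edgeGreen`. -/
noncomputable def edgeGreenLeft : Γ.Point → E → ℝ → ℝ
  | .vertex _, _, _ => 0
  | .interior e t _, e', s =>
      if e = e' then (if s ≤ t then (Γ.len e - t) / Γ.len e else -t / Γ.len e) else 0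

lemma edgeGreen_interior_self {e : E} {t : ℝ} (ht : 0 < t ∧ t < Γ.len e) :
    Γ.edgeGreen (.interior e t ht) e = fun s => min s t * (Γ.len e - max s t) / Γ.len e := by
  funext s; simp [edgeGreen]

lemma edgeGreen_interior_of_ne {e e' : E} {t : ℝ} (ht : 0 < t ∧ t < Γ.len e) (he : e ≠ e') :
    Γ.edgeGreen (.interior e t ht) e' = fun _ => 0 := by
  funext s; simp [edgeGreen, he]

lemma hasDerivWithinAt_edgeGreen_Ici (x : Γ.Point) (e : E) (s : ℝ) :
    HasDerivWithinAt (Γ.edgeGreen x e) (Γ.edgeGreenRight x e s) (Set.Ici s) s := by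
  rcases x with v | ⟨e', t, ht⟩
  · exact hasDerivWithinAt_const _ _ _
  · by_cases he : e' = e
    · subst he
      simpa [edgeGreen_interior_self, edgeGreenRight] using hasDerivWithinAt_tent_Ici s
    · simpa [Γ.edgeGreen_interior_of_ne ht he, edgeGreenRight, he] using
        hasDerivWithinAt_const _ _ _

lemma hasDerivWithinAt_edgeGreen_Iic (x : Γ.Point) (e : E) (s : ℝ) :
    HasDerivWithinAt (Γ.edgeGreen x e) (Γ.edgeGreenLeft x e s) (Set.Iic s) s := by
  rcases x with v | ⟨e', t, ht⟩
  · exact hasDerivWithinAt_const _ _ _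
  · by_cases he : e' = e
    · subst he
      simpa [edgeGreen_interior_self, edgeGreenLeft] using hasDerivWithinAt_tent_Iic s
    · simpa [Γ.edgeGreen_interior_of_ne ht he, edgeGreenLeft, he] using
        hasDerivWithinAt_const _ _ _

lemma hasDerivAt_edgeGreen (x : Γ.Point) {e : E} {s : ℝ} (hs : s ∈ Set.Ioo 0 (Γ.len e))
    (hx : Γ.pt e s ≠ x) : HasDerivAt (Γ.edgeGreen x e) (Γ.edgeGreenRight x e s) s := by
  rcases x with v | ⟨e', t, ht⟩
  · exact hasDerivAt_const _ _
  · by_cases he : e' = e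
    · subst he
      have hst : s ≠ t := by rintro rfl; exact hx (Γ.pt_of_mem ht)
      rcases hst.lt_or_gt with h | h
      · simpa [edgeGreen_interior_self, edgeGreenRight, h] using hasDerivAt_tent_of_lt h
      · simpa [edgeGreen_interior_self, edgeGreenRight, not_lt.2 h.le] using
          hasDerivAt_tent_of_gt h
    · simpa [Γ.edgeGreen_interior_of_ne ht he, edgeGreenRight, he] using hasDerivAt_const _ _

/-- The slope on the edge `e` of the barycentric interpolation of `w`. -/
noncomputable def edgeSlope (w : V → ℝ) (e : E) : ℝ := (w (Γ.tgt e) - w (Γ.src e)) / Γ.len e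

/-- The values on the vertices of the Green kernel with source `x`. -/
noncomputable def vertexGreen (G : V → V → ℝ) (x : Γ.Point) : V → ℝ := fun w => Γ.interp (G w) x

lemma green_pt_eq (G : V → V → ℝ) (x : Γ.Point) {e : E} {s : ℝ} (hs : s ∈ Set.Icc 0 (Γ.len e)) :
    Γ.green G x (Γ.pt e s) = Γ.vertexGreen G x (Γ.src e) +
      Γ.edgeSlope (Γ.vertexGreen G x) e * s + Γ.edgeGreen x e s := by
  rw [Γ.green_pt G x hs, Γ.interp_pt _ hs]; rfl

lemma hasDerivAt_affine (a b s : ℝ) : HasDerivAt (fun s => a + b * s) b s := by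
  simpa using ((hasDerivAt_id s).const_mul b).const_add a

lemma hasDerivWithinAt_green_Ici (G : V → V → ℝ) (x : Γ.Point) {e : E} {s : ℝ}
    (hs : s ∈ Set.Ico 0 (Γ.len e)) :
    HasDerivWithinAt (fun s => Γ.green G x (Γ.pt e s))
      (Γ.edgeSlope (Γ.vertexGreen G x) e + Γ.edgeGreenRight x e s) (Set.Ici s) s := by
  refine ((hasDerivAt_affine _ _ s).hasDerivWithinAt.add
    (Γ.hasDerivWithinAt_edgeGreen_Ici x e s)).congr_of_eventuallyEq ?_
      (Γ.green_pt_eq G x ⟨hs.1, hs.2.le⟩)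
  filter_upwards [Icc_mem_nhdsGE hs.2] with r hr
  exact Γ.green_pt_eq G x ⟨hs.1.trans hr.1, hr.2⟩

lemma hasDerivWithinAt_green_Iic (G : V → V → ℝ) (x : Γ.Point) {e : E} {s : ℝ}
    (hs : s ∈ Set.Ioc 0 (Γ.len e)) :
    HasDerivWithinAt (fun s => Γ.green G x (Γ.pt e s))
      (Γ.edgeSlope (Γ.vertexGreen G x) e + Γ.edgeGreenLeft x e s) (Set.Iic s) s := by
  refine ((hasDerivAt_affine _ _ s).hasDerivWithinAt.add
    (Γ.hasDerivWithinAt_edgeGreen_Iic x e s)).congr_of_eventuallyEq ?_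
      (Γ.green_pt_eq G x ⟨hs.1.le, hs.2⟩)
  filter_upwards [Icc_mem_nhdsLE hs.1] with r hr
  exact Γ.green_pt_eq G x ⟨hr.1, hr.2.trans hs.2⟩

lemma hasDerivAt_green (G : V → V → ℝ) {x : Γ.Point} {e : E} {s : ℝ}
    (hs : s ∈ Set.Ioo 0 (Γ.len e)) (hx : Γ.pt e s ≠ x) :
    HasDerivAt (fun s => Γ.green G x (Γ.pt e s))
      (Γ.edgeSlope (Γ.vertexGreen G x) e + Γ.edgeGreenRight x e s) s := by
  refine ((hasDerivAt_affine (Γ.vertexGreen G x (Γ.src e)) _ s).add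
    (Γ.hasDerivAt_edgeGreen x hs hx)).congr_of_eventuallyEq ?_
  filter_upwards [Icc_mem_nhds hs.1 hs.2] with r hr
  exact Γ.green_pt_eq G x hr

lemma edgeGreen_eventually_affine (x : Γ.Point) {e : E} {s : ℝ} (hs : s ∈ Set.Ioo 0 (Γ.len e))
    (hx : Γ.pt e s ≠ x) : ∃ m c : ℝ, ∀ᶠ r in 𝓝 s, Γ.edgeGreen x e r = m * r + c := by
  rcases x with v | ⟨e', t, ht⟩
  · exact ⟨0, 0, by simp [edgeGreen]⟩
  · by_cases he : e' = e
    · subst he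
      have hst : s ≠ t := by rintro rfl; exact hx (Γ.pt_of_mem ht)
      rw [edgeGreen_interior_self]
      rcases hst.lt_or_gt with h | h
      · refine ⟨(Γ.len e' - t) / Γ.len e', 0, ?_⟩
        filter_upwards [Iio_mem_nhds h] with r hr
        rw [min_eq_left (le_of_lt hr), max_eq_right (le_of_lt hr)]; ring
      · refine ⟨-t / Γ.len e', t * Γ.len e' / Γ.len e', ?_⟩
        filter_upwards [Ioi_mem_nhds h] with r hr
        rw [min_eq_right (le_of_lt hr), max_eq_left (le_of_lt hr)]; ring
    · exact ⟨0, 0, by simp [edgeGreen, he]⟩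

lemma isPiecewiseAffine_green (G : V → V → ℝ) (x : Γ.Point) :
    Γ.IsPiecewiseAffine (Γ.green G x) := by
  refine ⟨Γ.continuous_green G x, {x}, Set.finite_singleton x, fun e s h0 h1 hx => ?_⟩
  obtain ⟨m, c, hmc⟩ := Γ.edgeGreen_eventually_affine x ⟨h0, h1⟩ hx
  refine ⟨m + Γ.edgeSlope (Γ.vertexGreen G x) e, c + Γ.vertexGreen G x (Γ.src e), ?_⟩
  filter_upwards [hmc, Icc_mem_nhds h0 h1] with r hr hr'
  rw [Γ.green_pt_eq G x hr', hr]; ring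

variable [Fintype E] {Γ}

/-- Inside an edge, `vertexGreen` is the barycentric combination of the two end kernels, and both
sides are linear in the barycentric weights. -/
lemma IsGreen.energy_vertexGreen {o : V} {G : V → V → ℝ} (hG : Γ.IsGreen o G) (x : Γ.Point)
    (u : V → ℝ) : Γ.energy (Γ.vertexGreen G x) u = Γ.interp u x - u o := by
  rcases x with v | ⟨e, t, ht⟩
  · have : Γ.vertexGreen G (.vertex v) = G v := funext fun w => hG.symm w v
    rw [this, hG.energy]; rfl
  · have : Γ.vertexGreen G (.interior e t ht) =
        (1 - t / Γ.len e) • G (Γ.src e) + (t / Γ.len e) • G (Γ.tgt e) := by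
      funext w
      simp [vertexGreen, interp, hG.symm w]
    rw [this, energy_add_left, energy_smul_left, energy_smul_left, hG.energy, hG.energy]
    simp only [interp]; ring

open Classical in
-- The edge Green function sends its unit current to the two ends in barycentric proportions. This
-- offsets the interpolated source in `energy_vertexGreen`.
lemma edgeGreen_slopes_vertex (y : Γ.Point) (v : V) :
    ∑ e, ((if Γ.src e = v then Γ.edgeGreenRight y e 0 else 0) -
      (if Γ.tgt e = v then Γ.edgeGreenLeft y e (Γ.len e) else 0)) =
    Γ.interp (fun w => if w = v then 1 else 0) y - (if .vertex v = y then 1 else 0) := by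
  rcases y with w | ⟨e, t, ht⟩
  · simp [edgeGreenRight, edgeGreenLeft, interp, eq_comm]
  · rw [Finset.sum_eq_single e (fun e' _ he' => by
      simp [edgeGreenRight, edgeGreenLeft, Ne.symm he']) (by simp)]
    have hL := (Γ.len_pos e).ne'
    simp only [edgeGreenRight, edgeGreenLeft, interp, ht.1, not_le.2 ht.2, if_true, if_false,
      reduceCtorEq]
    split_ifs <;> field_simp <;> ring

open Classical in
-- At a vertex the interpolated part contributes minus the energy against the indicator of `v`, and
-- its barycentric source cancels against the edge slopes. Inside an edge only the kink of the edge
-- Green function contributes.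
theorem IsGreen.slopeSum_green {o : V} {G : V → V → ℝ} (hG : Γ.IsGreen o G) (y x : Γ.Point) :
    Γ.slopeSum (Γ.green G y) x = (if x = .vertex o then 1 else 0) - (if x = y then 1 else 0) := by
  rcases x with v | ⟨e, s, hs⟩
  · have h1 := hG.energy_vertexGreen y (fun w => if w = v then 1 else 0)
    have h2 := edgeGreen_slopes_vertex y v
    have h3 : Γ.slopeSum (Γ.green G y) (.vertex v) =
        -Γ.energy (Γ.vertexGreen G y) (fun w => if w = v then 1 else 0) +
        ∑ e, ((if Γ.src e = v then Γ.edgeGreenRight y e 0 else 0) -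
          (if Γ.tgt e = v then Γ.edgeGreenLeft y e (Γ.len e) else 0)) := by
      simp only [slopeSum, MetrizedGraph.energy, ← Finset.sum_neg_distrib, ← Finset.sum_add_distrib]
      refine Finset.sum_congr rfl fun e _ => ?_
      rw [(Γ.hasDerivWithinAt_green_Ici G y ⟨le_rfl, Γ.len_pos e⟩).derivWithin
        (uniqueDiffWithinAt_Ici _),
        (Γ.hasDerivWithinAt_green_Iic G y ⟨Γ.len_pos e, le_rfl⟩).derivWithin
        (uniqueDiffWithinAt_Iic _), edgeSlope]
      split_ifs <;> ring
    rw [h3, h1, h2]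
    simp only [Point.vertex.injEq, eq_comm (a := o)]
    ring
  · simp only [slopeSum]
    rw [(Γ.hasDerivWithinAt_green_Ici G y ⟨hs.1.le, hs.2⟩).derivWithin
        (uniqueDiffWithinAt_Ici _),
        (Γ.hasDerivWithinAt_green_Iic G y ⟨hs.1, hs.2.le⟩).derivWithin
        (uniqueDiffWithinAt_Iic _)]
    rcases y with w | ⟨e', t, ht⟩
    · simp [edgeGreenRight, edgeGreenLeft]
    · by_cases he : e' = e
      · subst he
        have hL := (Γ.len_pos e').ne'
        simp only [edgeGreenRight, edgeGreenLeft, if_true, reduceCtorEq, if_false,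
          Point.interior.injEq, true_and]
        rcases lt_trichotomy s t with h | h | h
        · simp [h, h.le, h.ne]
        · subst h
          simp only [lt_irrefl, le_refl, if_true, if_false]
          field_simp; ring
        · simp [h.ne', not_lt.2 h.le, not_le.2 h]
      · simp [edgeGreenRight, edgeGreenLeft, he, Ne.symm he]

/-- The voltage function in terms of the Green kernel. -/
theorem IsGreen.voltage_eq [Finite V] {o : V} {G : V → V → ℝ} (hG : Γ.IsGreen o G)
    (z x y : Γ.Point) : Γ.voltage z x y =
      Γ.green G y x - Γ.green G z x - (Γ.green G y z - Γ.green G z z) := by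
  -- In the difference of two Green functions the sinks at `o` cancel, leaving `δ_y - δ_z`; the
  -- constant normalizes the value at `z`.
  have hpa := (Γ.isPiecewiseAffine_green G y).sub (Γ.isPiecewiseAffine_green G z)
  have hc := isPiecewiseAffine_const (Γ := Γ) (Γ.green G y z - Γ.green G z z)
  refine voltage_eq_of_isVoltage (f := fun x => Γ.green G y x - Γ.green G z x -
    (Γ.green G y z - Γ.green G z z)) ⟨hpa.sub hc, by simp, fun x => ?_⟩ x
  rw [slopeSum_sub hpa.hasSlopes hc.hasSlopes, slopeSum_const,
    slopeSum_sub (Γ.isPiecewiseAffine_green G y).hasSlopes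
      (Γ.isPiecewiseAffine_green G z).hasSlopes, hG.slopeSum_green, hG.slopeSum_green]
  ring

theorem IsGreen.resistance_eq [Finite V] {o : V} {G : V → V → ℝ} (hG : Γ.IsGreen o G)
    (x y : Γ.Point) : Γ.resistance x y =
      Γ.green G x x + Γ.green G y y - 2 * Γ.green G x y := by
  rw [resistance, hG.voltage_eq, Γ.green_comm hG.symm y x]; ring

end Green

/-! ### The Dirichlet pairing on `Γ` and the reproducing property of the Green kernel -/

section Pairing

variable (Γ : MetrizedGraph V E)

/-- `F e` is the derivative of `f` on the edge `e`, outside of a finite set of points of `Γ`,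
and is measurable and bounded. -/
structure HasEdgeDeriv (f : Γ.Point → ℝ) (F : E → ℝ → ℝ) : Prop where
  continuous : Continuous f
  measurable : ∀ e, Measurable (F e)
  bounded : ∀ e, ∃ C, ∀ s ∈ Set.Icc 0 (Γ.len e), |F e s| ≤ C
  hasDerivAt : ∃ S : Set Γ.Point, S.Finite ∧ ∀ e, ∀ s ∈ Set.Ioo 0 (Γ.len e), Γ.pt e s ∉ S →
    HasDerivAt (fun s => f (Γ.pt e s)) (F e s) s

variable {Γ}

lemma HasEdgeDeriv.sub {f g : Γ.Point → ℝ} {F F' : E → ℝ → ℝ} (hf : Γ.HasEdgeDeriv f F)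
    (hg : Γ.HasEdgeDeriv g F') :
    Γ.HasEdgeDeriv (fun x => f x - g x) (fun e s => F e s - F' e s) where
  continuous := hf.continuous.sub hg.continuous
  measurable e := (hf.measurable e).sub (hg.measurable e)
  bounded e := by
    obtain ⟨C, hC⟩ := hf.bounded e
    obtain ⟨C', hC'⟩ := hg.bounded e
    exact ⟨C + C', fun s hs => (abs_sub _ _).trans (add_le_add (hC s hs) (hC' s hs))⟩
  hasDerivAt := by
    obtain ⟨S, hS, h⟩ := hf.hasDerivAt
    obtain ⟨S', hS', h'⟩ := hg.hasDerivAt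
    refine ⟨S ∪ S', hS.union hS', fun e s hs hx => ?_⟩
    exact (h e s hs fun hm => hx (.inl hm)).sub (h' e s hs fun hm => hx (.inr hm))

lemma HasEdgeDeriv.add_const {f : Γ.Point → ℝ} {F : E → ℝ → ℝ} (hf : Γ.HasEdgeDeriv f F)
    (c : ℝ) : Γ.HasEdgeDeriv (fun x => f x + c) F where
  continuous := hf.continuous.add continuous_const
  measurable := hf.measurable
  bounded := hf.bounded
  hasDerivAt := by
    obtain ⟨S, hS, h⟩ := hf.hasDerivAt
    exact ⟨S, hS, fun e s hs hx => (h e s hs hx).add_const c⟩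

lemma intervalIntegrable_of_bounded {f : ℝ → ℝ} {a b C : ℝ} (hab : a ≤ b) (hf : Measurable f)
    (hC : ∀ s ∈ Set.Icc a b, |f s| ≤ C) : IntervalIntegrable f volume a b := by
  rw [intervalIntegrable_iff_integrableOn_Icc_of_le hab]
  refine Measure.integrableOn_of_bounded (M := C) (by simp) hf.aestronglyMeasurable ?_
  filter_upwards [ae_restrict_mem measurableSet_Icc] with s hs
  exact hC s hs

lemma HasEdgeDeriv.intervalIntegrable {f : Γ.Point → ℝ} {F : E → ℝ → ℝ}
    (hf : Γ.HasEdgeDeriv f F) (e : E) : IntervalIntegrable (F e) volume 0 (Γ.len e) := by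
  obtain ⟨C, hC⟩ := hf.bounded e
  exact intervalIntegrable_of_bounded (Γ.len_pos e).le (hf.measurable e) hC

lemma HasEdgeDeriv.intervalIntegrable_mul {f g : Γ.Point → ℝ} {F F' : E → ℝ → ℝ}
    (hf : Γ.HasEdgeDeriv f F) (hg : Γ.HasEdgeDeriv g F') (e : E) :
    IntervalIntegrable (fun s => F e s * F' e s) volume 0 (Γ.len e) := by
  obtain ⟨C, hC⟩ := hf.bounded e
  obtain ⟨C', hC'⟩ := hg.bounded e
  refine intervalIntegrable_of_bounded (C := C * C') (Γ.len_pos e).le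
    ((hf.measurable e).mul (hg.measurable e)) fun s hs => ?_
  rw [abs_mul]
  exact mul_le_mul (hC s hs) (hC' s hs) (abs_nonneg _) ((abs_nonneg _).trans (hC s hs))

lemma HasEdgeDeriv.ae_deriv_eq {f : Γ.Point → ℝ} {F : E → ℝ → ℝ} (hf : Γ.HasEdgeDeriv f F)
    (e : E) : ∀ᵐ s ∂volume, s ∈ Set.uIoc 0 (Γ.len e) →
      deriv (fun s => f (Γ.pt e s)) s = F e s := by
  obtain ⟨S, hS, h⟩ := hf.hasDerivAt
  -- `uIoc` contains its right end, so `len e` joins the null set.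
  have hfin := (Γ.finite_pt_mem hS e).union (Set.finite_singleton (Γ.len e))
  filter_upwards [compl_mem_ae_iff.2 (hfin.measure_zero volume)] with s hs hs'
  rw [Set.uIoc_of_le (Γ.len_pos e).le] at hs'
  have hne : s ≠ Γ.len e := fun h => hs (.inr h)
  have hs'' : s ∈ Set.Ioo 0 (Γ.len e) := ⟨hs'.1, lt_of_le_of_ne hs'.2 hne⟩
  exact (h e s hs'' fun hm => hs (.inl ⟨hs'', hm⟩)).deriv

lemma HasEdgeDeriv.hasDerivSqIntegral {f : Γ.Point → ℝ} {F : E → ℝ → ℝ}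
    (hf : Γ.HasEdgeDeriv f F) : Γ.HasDerivSqIntegral f := by
  constructor
  · obtain ⟨S, hS, h⟩ := hf.hasDerivAt
    exact ⟨S, hS, fun e t h0 h1 ht => (h e t ⟨h0, h1⟩ ht).differentiableAt⟩
  · intro e
    refine (hf.intervalIntegrable_mul hf e).congr_ae ?_
    rw [Filter.EventuallyEq, ae_restrict_iff' measurableSet_uIoc]
    filter_upwards [hf.ae_deriv_eq e] with s hs hs'
    rw [hs hs', sq]

/-- The fundamental theorem of calculus tolerates countably many points without derivative, provided
that `f` is continuous there. -/
lemma HasEdgeDeriv.integral_eq {f : Γ.Point → ℝ} {F : E → ℝ → ℝ} (hf : Γ.HasEdgeDeriv f F)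
    {e : E} {a b : ℝ} (ha : 0 ≤ a) (hab : a ≤ b) (hb : b ≤ Γ.len e) :
    ∫ s in a..b, F e s = f (Γ.pt e b) - f (Γ.pt e a) := by
  obtain ⟨S, hS, h⟩ := hf.hasDerivAt
  refine integral_eq_of_hasDerivAt_off_countable (fun s => f (Γ.pt e s)) (F e)
    (Γ.finite_pt_mem hS e).countable
    (hf.continuous.comp (Γ.continuous_pt e)).continuousOn (fun s hs => ?_) ?_
  · rw [min_eq_left hab, max_eq_right hab] at hs
    have hs' : s ∈ Set.Ioo 0 (Γ.len e) := ⟨ha.trans_lt hs.1.1, hs.1.2.trans_le hb⟩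
    exact h e s hs' fun hm => hs.2 ⟨hs', hm⟩
  · refine (hf.intervalIntegrable e).mono_set ?_
    rw [Set.uIcc_of_le hab, Set.uIcc_of_le (Γ.len_pos e).le]
    exact Set.Icc_subset_Icc ha hb

variable [Fintype E]

variable (Γ) in
/-- The sum of the integrals over the edges of the product of `F` and `F'`. -/
noncomputable def edgePairing (F F' : E → ℝ → ℝ) : ℝ :=
  ∑ e, ∫ s in (0 : ℝ)..Γ.len e, F e s * F' e s

lemma edgePairing_comm (F F' : E → ℝ → ℝ) : Γ.edgePairing F F' = Γ.edgePairing F' F := by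
  simp only [edgePairing, mul_comm]

lemma HasEdgeDeriv.edgePairing_sub_left {f g h : Γ.Point → ℝ} {F F' H : E → ℝ → ℝ}
    (hf : Γ.HasEdgeDeriv f F) (hg : Γ.HasEdgeDeriv g F') (hh : Γ.HasEdgeDeriv h H) :
    Γ.edgePairing (fun e s => F e s - F' e s) H = Γ.edgePairing F H - Γ.edgePairing F' H := by
  simp only [edgePairing, ← Finset.sum_sub_distrib, sub_mul]
  exact Finset.sum_congr rfl fun e _ => intervalIntegral.integral_sub
    (hf.intervalIntegrable_mul hh e) (hg.intervalIntegrable_mul hh e)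

lemma HasEdgeDeriv.derivSqIntegral_eq {f : Γ.Point → ℝ} {F : E → ℝ → ℝ}
    (hf : Γ.HasEdgeDeriv f F) : Γ.derivSqIntegral f = Γ.edgePairing F F := by
  refine Finset.sum_congr rfl fun e _ => intervalIntegral.integral_congr_ae ?_
  filter_upwards [hf.ae_deriv_eq e] with s hs hs'
  rw [hs hs', sq]

variable (Γ) in
/-- The derivative of the Green kernel with source `x`. -/
noncomputable def greenDeriv (G : V → V → ℝ) (x : Γ.Point) (e : E) (s : ℝ) : ℝ :=
  Γ.edgeSlope (Γ.vertexGreen G x) e + Γ.edgeGreenRight x e s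

omit [Fintype E] in
lemma measurable_edgeGreenRight (x : Γ.Point) (e : E) : Measurable (Γ.edgeGreenRight x e) := by
  rcases x with v | ⟨e', t, ht⟩
  · exact measurable_const
  · by_cases he : e' = e
    · have : Γ.edgeGreenRight (.interior e' t ht) e =
          fun s => if s < t then (Γ.len e' - t) / Γ.len e' else -t / Γ.len e' := by
        funext s; simp [edgeGreenRight, he]
      rw [this]
      exact Measurable.ite measurableSet_Iio measurable_const measurable_const
    · have : Γ.edgeGreenRight (.interior e' t ht) e = fun _ => 0 := by
        funext s; simp [edgeGreenRight, he]
      rw [this]; exact measurable_const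

omit [Fintype E] in
lemma exists_abs_edgeGreenRight_le (x : Γ.Point) (e : E) :
    ∃ C, ∀ s, |Γ.edgeGreenRight x e s| ≤ C := by
  rcases x with v | ⟨e', t, ht⟩
  · exact ⟨0, by simp [edgeGreenRight]⟩
  · refine ⟨|(Γ.len e' - t) / Γ.len e'| + |-t / Γ.len e'|, fun s => ?_⟩
    have h1 := abs_nonneg ((Γ.len e' - t) / Γ.len e')
    have h2 := abs_nonneg (-t / Γ.len e')
    simp only [edgeGreenRight]
    split_ifs
    · linarith
    · linarith
    · rw [abs_zero]; linarith

omit [Fintype E] in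
lemma hasEdgeDeriv_green (G : V → V → ℝ) (x : Γ.Point) :
    Γ.HasEdgeDeriv (Γ.green G x) (Γ.greenDeriv G x) where
  continuous := Γ.continuous_green G x
  measurable e := measurable_const.add (measurable_edgeGreenRight x e)
  bounded e := by
    obtain ⟨C, hC⟩ := exists_abs_edgeGreenRight_le x e
    exact ⟨|Γ.edgeSlope (Γ.vertexGreen G x) e| + C, fun s _ =>
      (abs_add_le _ _).trans (add_le_add le_rfl (hC s))⟩
  hasDerivAt := ⟨{x}, Set.finite_singleton x, fun _ _ hs hx => Γ.hasDerivAt_green G hs hx⟩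

omit [Fintype E] in
-- The second factor is constant on each side of `t`, so the integral is `(L - t) / L * (f(t) -
-- f(0)) - t / L * (f(L) - f(t))`: the deviation of `f` from its chord.
lemma HasEdgeDeriv.integral_mul_edgeGreenRight {f : Γ.Point → ℝ} {F : E → ℝ → ℝ}
    (hf : Γ.HasEdgeDeriv f F) {e : E} {t : ℝ} (ht : 0 < t ∧ t < Γ.len e) :
    ∫ s in (0 : ℝ)..Γ.len e, F e s * Γ.edgeGreenRight (.interior e t ht) e s =
      f (.interior e t ht) - Γ.interp (fun v => f (.vertex v)) (.interior e t ht) := by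
  have hL := (Γ.len_pos e).ne'
  have hi := hf.intervalIntegrable e
  have hi0 : IntervalIntegrable (F e) volume 0 t := hi.mono_set (by
    rw [Set.uIcc_of_le ht.1.le, Set.uIcc_of_le (Γ.len_pos e).le]
    exact Set.Icc_subset_Icc le_rfl ht.2.le)
  have hi1 : IntervalIntegrable (F e) volume t (Γ.len e) := hi.mono_set (by
    rw [Set.uIcc_of_le ht.2.le, Set.uIcc_of_le (Γ.len_pos e).le]
    exact Set.Icc_subset_Icc ht.1.le le_rfl)
  have hne : ∀ᵐ s : ℝ ∂volume, s ≠ t := by simp [ae_iff]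
  have h0 : ∀ᵐ s ∂volume, s ∈ Set.uIoc 0 t →
      F e s * ((Γ.len e - t) / Γ.len e) = F e s * Γ.edgeGreenRight (.interior e t ht) e s := by
    filter_upwards [hne] with s hs hs'
    rw [Set.uIoc_of_le ht.1.le] at hs'
    simp [edgeGreenRight, lt_of_le_of_ne hs'.2 hs]
  have h1 : ∀ᵐ s ∂volume, s ∈ Set.uIoc t (Γ.len e) →
      F e s * (-t / Γ.len e) = F e s * Γ.edgeGreenRight (.interior e t ht) e s := by
    filter_upwards with s hs'
    rw [Set.uIoc_of_le ht.2.le] at hs'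
    simp [edgeGreenRight, not_lt.2 hs'.1.le]
  rw [← intervalIntegral.integral_add_adjacent_intervals
      ((hi0.mul_const _).congr_ae ((ae_restrict_iff' measurableSet_uIoc).2 h0))
      ((hi1.mul_const _).congr_ae ((ae_restrict_iff' measurableSet_uIoc).2 h1)),
    ← intervalIntegral.integral_congr_ae h0, ← intervalIntegral.integral_congr_ae h1,
    intervalIntegral.integral_mul_const, intervalIntegral.integral_mul_const,
    hf.integral_eq le_rfl ht.1.le ht.2.le, hf.integral_eq ht.1.le ht.2.le le_rfl,
    Γ.pt_of_mem ht, pt_zero, pt_len]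
  simp only [interp]
  field_simp
  ring

/-- The reproducing property of the Green kernel. -/
theorem HasEdgeDeriv.edgePairing_green {o : V} {G : V → V → ℝ} (hG : Γ.IsGreen o G)
    {f : Γ.Point → ℝ} {F : E → ℝ → ℝ} (hf : Γ.HasEdgeDeriv f F) (x : Γ.Point) :
    Γ.edgePairing F (Γ.greenDeriv G x) = f x - f (.vertex o) := by
  obtain ⟨u, hu⟩ : ∃ u : V → ℝ, u = fun v => f (.vertex v) := ⟨_, rfl⟩
  -- The constant slope yields an energy summand, in total `interp u x - u o`; the edge Green part
  -- supplies the deviation `f x - interp u x`.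
  have hsplit : ∀ e, ∫ s in (0 : ℝ)..Γ.len e, F e s * Γ.greenDeriv G x e s =
      (Γ.vertexGreen G x (Γ.tgt e) - Γ.vertexGreen G x (Γ.src e)) *
        (u (Γ.tgt e) - u (Γ.src e)) / Γ.len e +
      ∫ s in (0 : ℝ)..Γ.len e, F e s * Γ.edgeGreenRight x e s := by
    intro e
    obtain ⟨C, hC⟩ := exists_abs_edgeGreenRight_le x e
    obtain ⟨C', hC'⟩ := hf.bounded e
    have hi : IntervalIntegrable (fun s => F e s * Γ.edgeGreenRight x e s) volume 0 (Γ.len e) :=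
      intervalIntegrable_of_bounded (C := C' * C) (Γ.len_pos e).le
        ((hf.measurable e).mul (measurable_edgeGreenRight x e)) fun s hs => by
          rw [abs_mul]
          exact mul_le_mul (hC' s hs) (hC s) (abs_nonneg _) ((abs_nonneg _).trans (hC' s hs))
    simp only [greenDeriv, mul_add]
    rw [intervalIntegral.integral_add ((hf.intervalIntegrable e).mul_const _) hi,
      intervalIntegral.integral_mul_const, hf.integral_eq le_rfl (Γ.len_pos e).le le_rfl,
      pt_zero, pt_len, edgeSlope, hu]
    ring
  have hsum : ∑ e, ∫ s in (0 : ℝ)..Γ.len e, F e s * Γ.edgeGreenRight x e s =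
      f x - Γ.interp u x := by
    rcases x with v | ⟨e, t, ht⟩
    · simp [edgeGreenRight, interp, hu]
    · rw [Finset.sum_eq_single e (fun e' _ he' => by simp [edgeGreenRight, Ne.symm he'])
        (by simp), hf.integral_mul_edgeGreenRight ht, hu]
  have hen := hG.energy_vertexGreen x u
  rw [MetrizedGraph.energy] at hen
  rw [edgePairing, Finset.sum_congr rfl fun e _ => hsplit e, Finset.sum_add_distrib, hen, hsum, hu]
  ring

/-! ### The diagonal of the Green kernel -/

variable (Γ) in
/-- The derivative of the diagonal of the Green kernel. -/
noncomputable def diagDeriv (G : V → V → ℝ) (e : E) (s : ℝ) : ℝ :=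
  Γ.edgeSlope (fun v => G v v) e + Γ.diagCoeff G e * (Γ.len e - 2 * s)

omit [Fintype E] in
lemma hasEdgeDeriv_diag {G : V → V → ℝ} (hG : ∀ v w, G v w = G w v) :
    Γ.HasEdgeDeriv (fun x => Γ.green G x x) (Γ.diagDeriv G) where
  continuous := Γ.continuous_of_continuousOn fun e =>
    ContinuousOn.congr (by fun_prop) fun s hs => Γ.green_diag_pt hG hs
  measurable e := by unfold diagDeriv; fun_prop
  bounded e := (isCompact_Icc (a := (0 : ℝ)) (b := Γ.len e)).exists_bound_of_continuousOn
    (f := Γ.diagDeriv G e) (by unfold diagDeriv; fun_prop)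
  hasDerivAt := by
    refine ⟨∅, Set.finite_empty, fun e s hs _ => ?_⟩
    have hq : HasDerivAt (fun s => Γ.diagCoeff G e * (s * (Γ.len e - s)))
        (Γ.diagCoeff G e * (Γ.len e - 2 * s)) s := by
      refine HasDerivAt.congr_deriv (((hasDerivAt_id s).mul ((hasDerivAt_id s).const_sub (Γ.len e))).const_mul
        (Γ.diagCoeff G e)) ?_
      simp only [id]; ring
    refine ((hasDerivAt_affine (G (Γ.src e) (Γ.src e)) _ s).add hq).congr_of_eventuallyEq ?_
    filter_upwards [Icc_mem_nhds hs.1 hs.2] with r hr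
    exact Γ.green_diag_pt hG hr

lemma integral_mul_len_sub (L : ℝ) : ∫ s in (0 : ℝ)..L, s * (L - s) = L ^ 3 / 6 := by
  have : ∀ s ∈ Set.uIcc 0 L, HasDerivAt (fun s => L * s ^ 2 / 2 - s ^ 3 / 3) (s * (L - s)) s := by
    intro s _
    refine HasDerivAt.congr_deriv (((((hasDerivAt_id s).pow 2).const_mul L).div_const 2).sub
      (((hasDerivAt_id s).pow 3).div_const 3)) ?_
    simp only [id]; push_cast; ring
  rw [intervalIntegral.integral_eq_sub_of_hasDerivAt this
    (Continuous.intervalIntegrable (by fun_prop) _ _)]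
  ring

lemma integral_affine_sq (β c L : ℝ) :
    ∫ s in (0 : ℝ)..L, (β + c * (L - 2 * s)) * (β + c * (L - 2 * s)) =
      β ^ 2 * L + c ^ 2 * L ^ 3 / 3 := by
  have h : ∀ s : ℝ, (β + c * (L - 2 * s)) * (β + c * (L - 2 * s)) =
      (β + c * L) ^ 2 - 4 * (β + c * L) * c * s + 4 * c ^ 2 * s ^ 2 := fun s => by ring
  have : ∀ s ∈ Set.uIcc 0 L, HasDerivAt (fun s => (β + c * L) ^ 2 * s -
      2 * (β + c * L) * c * s ^ 2 + 4 * c ^ 2 * (s ^ 3 / 3))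
      ((β + c * (L - 2 * s)) * (β + c * (L - 2 * s))) s := by
    intro s _
    refine HasDerivAt.congr_deriv ((((hasDerivAt_id s).const_mul ((β + c * L) ^ 2)).sub
      (((hasDerivAt_id s).pow 2).const_mul (2 * (β + c * L) * c))).add
      ((((hasDerivAt_id s).pow 3).div_const 3).const_mul (4 * c ^ 2))) ?_
    simp only [id]; push_cast; ring
  rw [intervalIntegral.integral_eq_sub_of_hasDerivAt this
    (Continuous.intervalIntegrable (by fun_prop) _ _)]
  ring

/-- The cross terms vanish because `L - 2 * s` has mean zero on `[0, L]`. -/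
lemma edgePairing_diagDeriv (G : V → V → ℝ) :
    Γ.edgePairing (Γ.diagDeriv G) (Γ.diagDeriv G) =
      Γ.energy (fun v => G v v) (fun v => G v v) +
        ∑ e, Γ.diagCoeff G e ^ 2 * Γ.len e ^ 3 / 3 := by
  rw [edgePairing, energy, ← Finset.sum_add_distrib]
  refine Finset.sum_congr rfl fun e _ => ?_
  have hL := (Γ.len_pos e).ne'
  simp only [diagDeriv]
  rw [integral_affine_sq, edgeSlope]
  field_simp

/-- `∫ (d/dx j_x(p, q))² dx + r(p, q)` does not depend on `p` and `q`. -/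
theorem IsGreen.derivSqIntegral_voltage [Finite V] {o : V} {G : V → V → ℝ} (hG : Γ.IsGreen o G)
    (p q : Γ.Point) : Γ.HasDerivSqIntegral (fun x => Γ.voltage x p q) ∧
      Γ.derivSqIntegral (fun x => Γ.voltage x p q) + Γ.resistance p q =
        Γ.edgePairing (Γ.diagDeriv G) (Γ.diagDeriv G) := by
  have hd := hasEdgeDeriv_diag (Γ := Γ) hG.symm
  have hp := hasEdgeDeriv_green (Γ := Γ) G p
  have hq := hasEdgeDeriv_green (Γ := Γ) G q
  have hj := ((hd.sub hp).sub hq).add_const (Γ.green G q p)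
  have heq : (fun x => Γ.voltage x p q) = fun x =>
      Γ.green G x x - Γ.green G p x - Γ.green G q x + Γ.green G q p := by
    funext x
    rw [hG.voltage_eq, Γ.green_comm hG.symm x p]; ring
  have hbase : ∀ x, Γ.green G x (.vertex o) = 1 := fun x => by
    have : G o = fun _ => 1 := funext fun v => by rw [hG.symm, hG.base]
    simp only [green, this, interp_const]
  rw [heq]
  refine ⟨hj.hasDerivSqIntegral, ?_⟩
  have hdp := hd.edgePairing_green hG p
  have hdq := hd.edgePairing_green hG q
  have hpp := hp.edgePairing_green hG p
  have hpq := hp.edgePairing_green hG q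
  have hqq := hq.edgePairing_green hG q
  have hqp := hq.edgePairing_green hG p
  -- Bilinear expansion of the square of `d - g_p - g_q`: `edgePairing_comm` moves each difference
  -- to the left, and the reproducing property evaluates every pairing except `⟨d, d⟩`.
  rw [hj.derivSqIntegral_eq, (hd.sub hp).edgePairing_sub_left hq hj,
    hd.edgePairing_sub_left hp hj, edgePairing_comm _ fun _ _ => _,
    edgePairing_comm (Γ.greenDeriv G p) fun _ _ => _,
    edgePairing_comm (Γ.greenDeriv G q) fun _ _ => _,
    (hd.sub hp).edgePairing_sub_left hq hd, hd.edgePairing_sub_left hp hd,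
    (hd.sub hp).edgePairing_sub_left hq hp, hd.edgePairing_sub_left hp hp,
    (hd.sub hp).edgePairing_sub_left hq hq, hd.edgePairing_sub_left hp hq,
    edgePairing_comm (Γ.greenDeriv G p) (Γ.diagDeriv G),
    edgePairing_comm (Γ.greenDeriv G q) (Γ.diagDeriv G),
    hdp, hdq, hpp, hpq, hqq, hqp, hG.resistance_eq, Γ.green_comm hG.symm q p]
  simp only [hbase]
  ring

end Pairing

end MetrizedGraph

/-! ### Integrals against signed measures -/

section SignedMeasure

variable {X : Type*} [MeasurableSpace X]

lemma isFiniteMeasure_variation (μ : SignedMeasure X) : IsFiniteMeasure μ.variation := by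
  rw [← SignedMeasure.totalVariation_eq_variation, SignedMeasure.totalVariation]
  infer_instance

lemma vectorMeasure_integrable_of_bounded (μ : SignedMeasure X) {f : X → ℝ} (hf : Measurable f)
    {C : ℝ} (hC : ∀ x, |f x| ≤ C) : μ.Integrable f :=
  have := isFiniteMeasure_variation μ
  Integrable.of_bound hf.aestronglyMeasurable C (Filter.Eventually.of_forall hC)

lemma signedMeasure_integral_one (μ : SignedMeasure X) : ∫ᵛ _, (1 : ℝ) ∂•μ = μ Set.univ := by
  have := isFiniteMeasure_variation μ
  simp

lemma integral_lsmul_toSignedMeasure (μ : Measure X) [IsFiniteMeasure μ] (f : X → ℝ) :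
    ∫ᵛ x, f x ∂•μ.toSignedMeasure = ∫ x, f x ∂μ := by
  have : ContinuousLinearMap.lsmul ℝ ℝ = (ContinuousLinearMap.lsmul ℝ ℝ (E := ℝ)).flip := by
    ext; simp
  rw [this, VectorMeasure.integral_toSignedMeasure]

lemma signedMeasure_integral_eq_sub (μ : SignedMeasure X) {f : X → ℝ} (hf : Measurable f)
    {C : ℝ} (hC : ∀ x, |f x| ≤ C) : ∫ᵛ x, f x ∂•μ =
      ∫ x, f x ∂μ.toJordanDecomposition.posPart - ∫ x, f x ∂μ.toJordanDecomposition.negPart := by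
  conv_lhs => rw [← μ.toSignedMeasure_toJordanDecomposition, JordanDecomposition.toSignedMeasure]
  rw [VectorMeasure.integral_sub_vectorMeasure (vectorMeasure_integrable_of_bounded _ hf hC)
    (vectorMeasure_integrable_of_bounded _ hf hC), integral_lsmul_toSignedMeasure,
    integral_lsmul_toSignedMeasure]

lemma abs_intervalIntegral_le_of_bounded {f : ℝ → ℝ} {C : ℝ} (hC : ∀ t, |f t| ≤ C) (a b : ℝ) :
    |∫ t in a..b, f t| ≤ C * |b - a| :=
  intervalIntegral.norm_integral_le_of_norm_le_const (f := f) fun t _ => hC t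

lemma measurable_intervalIntegral {k : X → ℝ → ℝ} (hk : Measurable (Function.uncurry k))
    {L : ℝ} (hL : 0 ≤ L) : Measurable fun x => ∫ t in (0 : ℝ)..L, k x t := by
  simp only [intervalIntegral.integral_of_le hL]
  exact hk.stronglyMeasurable.integral_prod_right.measurable

/-- Fubini's theorem for a signed measure and an interval integral. -/
lemma signedMeasure_integral_intervalIntegral (μ : SignedMeasure X) {k : X → ℝ → ℝ}
    (hk : Measurable (Function.uncurry k)) {C : ℝ} (hC : ∀ x t, |k x t| ≤ C) {L : ℝ}
    (hL : 0 ≤ L) :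
    ∫ᵛ x, (∫ t in (0 : ℝ)..L, k x t) ∂•μ = ∫ t in (0 : ℝ)..L, (∫ᵛ x, k x t ∂•μ) := by
  -- Fubini holds for a finite positive measure; it is applied to both parts of the Jordan
  -- decomposition.
  have hF : ∀ (P : Measure X) [IsFiniteMeasure P],
      ∫ x, (∫ t in (0 : ℝ)..L, k x t) ∂P = ∫ t in (0 : ℝ)..L, (∫ x, k x t ∂P) ∧
      IntervalIntegrable (fun t => ∫ x, k x t ∂P) volume 0 L := by
    intro P _
    have hint : Integrable (Function.uncurry k) (P.prod (volume.restrict (Set.Ioc 0 L))) :=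
      Integrable.of_bound hk.aestronglyMeasurable C
        (Filter.Eventually.of_forall fun x => hC x.1 x.2)
    constructor
    · simp only [intervalIntegral.integral_of_le hL]
      exact integral_integral_swap hint
    · rw [intervalIntegrable_iff_integrableOn_Ioc_of_le hL]
      exact hint.integral_prod_right
  rw [signedMeasure_integral_eq_sub μ (measurable_intervalIntegral hk hL)
    (fun x => abs_intervalIntegral_le_of_bounded (hC x) 0 L), (hF _).1, (hF _).1,
    ← intervalIntegral.integral_sub (hF _).2 (hF _).2]
  refine intervalIntegral.integral_congr fun t _ => ?_
  exact (signedMeasure_integral_eq_sub μ (hk.comp measurable_prodMk_right)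
    fun x => hC x t).symm

end SignedMeasure

namespace MetrizedGraph

variable {V E : Type*}

/-! ### The canonical measure -/

section Canonical

variable (Γ : MetrizedGraph V E)

lemma abs_interp_le [Fintype V] (w : V → ℝ) (x : Γ.Point) : |Γ.interp w x| ≤ ∑ v, |w v| := by
  have h : ∀ v, |w v| ≤ ∑ v, |w v| := fun v =>
    Finset.single_le_sum (f := fun v => |w v|) (fun v _ => abs_nonneg _) (Finset.mem_univ v)
  rcases x with v | ⟨e, t, ht⟩
  · exact h v
  · have hL := Γ.len_pos e
    have h0 : 0 ≤ t / Γ.len e := div_nonneg ht.1.le hL.le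
    have h1 : t / Γ.len e ≤ 1 := (div_le_one hL).2 ht.2.le
    calc |Γ.interp w (.interior e t ht)|
        ≤ |(1 - t / Γ.len e) * w (Γ.src e)| + |t / Γ.len e * w (Γ.tgt e)| := abs_add_le _ _
      _ ≤ (1 - t / Γ.len e) * (∑ v, |w v|) + t / Γ.len e * ∑ v, |w v| := by
          rw [abs_mul, abs_mul, abs_of_nonneg h0, abs_of_nonneg (sub_nonneg.2 h1)]
          exact add_le_add (mul_le_mul_of_nonneg_left (h _) (sub_nonneg.2 h1))
            (mul_le_mul_of_nonneg_left (h _) h0)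
      _ = ∑ v, |w v| := by ring

/-- The resistance in terms of the Green kernel. -/
noncomputable def greenResistance (G : V → V → ℝ) (x y : Γ.Point) : ℝ :=
  Γ.green G x x + Γ.green G y y - 2 * Γ.green G x y

/-- The Lebesgue measure on an edge. -/
noncomputable def edgeMeasure (e : E) : Measure Γ.Point :=
  (volume.restrict (Set.Ioc 0 (Γ.len e))).map (Γ.pt e)

instance (e : E) : IsFiniteMeasure (Γ.edgeMeasure e) := by
  unfold edgeMeasure; infer_instance

variable [Fintype E]

lemma abs_edgeGreen_le (x : Γ.Point) {e : E} {s : ℝ} (hs : s ∈ Set.Icc 0 (Γ.len e)) :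
    |Γ.edgeGreen x e s| ≤ ∑ e, Γ.len e := by
  have hsum : Γ.len e ≤ ∑ e, Γ.len e :=
    Finset.single_le_sum (fun e _ => (Γ.len_pos e).le) (Finset.mem_univ e)
  have hL := Γ.len_pos e
  rcases x with v | ⟨e', t, ht⟩
  · simpa [edgeGreen] using hL.le.trans hsum
  · by_cases he : e' = e
    · subst he
      simp only [edgeGreen, if_true]
      have h0 : 0 ≤ min s t := le_min hs.1 ht.1.le
      have h1 : min s t ≤ Γ.len e' := (min_le_right _ _).trans ht.2.le
      have h2 : 0 ≤ Γ.len e' - max s t := sub_nonneg.2 (max_le hs.2 ht.2.le)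
      have h3 : Γ.len e' - max s t ≤ Γ.len e' := by
        linarith [ht.1.le.trans (le_max_right s t)]
      rw [abs_of_nonneg (div_nonneg (mul_nonneg h0 h2) hL.le)]
      refine le_trans ?_ hsum
      rw [div_le_iff₀ hL]
      exact mul_le_mul h1 h3 h2 hL.le
    · simpa [edgeGreen, he] using hL.le.trans hsum

lemma exists_abs_green_le [Finite V] (G : V → V → ℝ) :
    ∃ C, ∀ x y, |Γ.green G x y| ≤ C := by
  cases nonempty_fintype V
  refine ⟨(∑ w, ∑ v, |G w v|) + ∑ e, Γ.len e, fun x y => ?_⟩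
  have h1 : |Γ.interp (fun w => Γ.interp (G w) x) y| ≤ ∑ w, ∑ v, |G w v| :=
    (Γ.abs_interp_le _ y).trans (Finset.sum_le_sum fun w _ => Γ.abs_interp_le (G w) x)
  rcases y with v | ⟨e, s, hs⟩
  · refine h1.trans (le_add_of_nonneg_right (Finset.sum_nonneg fun e _ => (Γ.len_pos e).le))
  · exact (abs_add_le _ _).trans (add_le_add h1 (Γ.abs_edgeGreen_le x ⟨hs.1.le, hs.2.le⟩))

variable {Γ}

lemma IsGreen.voltage_diag [Finite V] {o : V} {G : V → V → ℝ} (hG : Γ.IsGreen o G)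
    (ζ x : Γ.Point) : Γ.voltage ζ x x = Γ.greenResistance G ζ x :=
  hG.resistance_eq ζ x

lemma exists_abs_greenResistance_le [Finite V] (G : V → V → ℝ) :
    ∃ C, ∀ x y, |Γ.greenResistance G x y| ≤ C := by
  obtain ⟨C, hC⟩ := Γ.exists_abs_green_le G
  refine ⟨4 * C, fun x y => ?_⟩
  have h1 := abs_le.1 (hC x x)
  have h2 := abs_le.1 (hC y y)
  have h3 := abs_le.1 (hC x y)
  rw [greenResistance, abs_le]
  constructor <;> linarith [h1.1, h1.2, h2.1, h2.2, h3.1, h3.2]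

omit [Fintype E] in
lemma greenResistance_comm {G : V → V → ℝ} (hG : ∀ v w, G v w = G w v) (x y : Γ.Point) :
    Γ.greenResistance G x y = Γ.greenResistance G y x := by
  rw [greenResistance, greenResistance, Γ.green_comm hG x y]; ring

omit [Fintype E] in
lemma continuous_greenResistance {G : V → V → ℝ} (hG : ∀ v w, G v w = G w v) (x : Γ.Point) :
    Continuous (Γ.greenResistance G x) :=
  (continuous_const.add (hasEdgeDeriv_diag hG).continuous).sub
    (continuous_const.mul (Γ.continuous_green G x))

variable (Γ)

/-- The integral of `f` against the canonical measure. -/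
noncomputable def canonicalFunctional (o : V) (G : V → V → ℝ) (f : Γ.Point → ℝ) : ℝ :=
  f (.vertex o) + ∑ e, (Γ.edgeSlope (fun v => G v v) e / 2 *
      (f (.vertex (Γ.tgt e)) - f (.vertex (Γ.src e))) +
    Γ.diagCoeff G e * ((∫ s in (0 : ℝ)..Γ.len e, f (Γ.pt e s)) -
      Γ.len e / 2 * (f (.vertex (Γ.src e)) + f (.vertex (Γ.tgt e)))))

/-- An explicit canonical measure. -/
noncomputable def explicitMeasure (o : V) (G : V → V → ℝ) : SignedMeasure Γ.Point :=
  .dirac (.vertex o) 1 + ∑ e, ((Γ.edgeSlope (fun v => G v v) e / 2) •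
      (.dirac (.vertex (Γ.tgt e)) 1 - .dirac (.vertex (Γ.src e)) 1) +
    Γ.diagCoeff G e • ((Γ.edgeMeasure e).toSignedMeasure -
      (Γ.len e / 2) • (.dirac (.vertex (Γ.src e)) 1 + .dirac (.vertex (Γ.tgt e)) 1)))

variable {Γ}

/-- For differentiable `f`, integrating `d' f' / 2` by parts on an edge, with `d'' = -2 *
diagCoeff`, gives the edge term of `canonicalFunctional`. The measure is thus `δ_o + Δd / 2`,
written without derivatives of `f`. -/
lemma integral_explicitMeasure (o : V) (G : V → V → ℝ) {f : Γ.Point → ℝ} (hf : Continuous f)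
    {C : ℝ} (hC : ∀ x, |f x| ≤ C) :
    ∫ᵛ x, f x ∂•(Γ.explicitMeasure o G) = Γ.canonicalFunctional o G f := by
  have hi : ∀ μ : SignedMeasure Γ.Point, μ.Integrable f := fun μ =>
    vectorMeasure_integrable_of_bounded μ hf.measurable hC
  have hd : ∀ x : Γ.Point, ∫ᵛ x, f x ∂•(VectorMeasure.dirac x (1 : ℝ)) = f x := fun x => by
    rw [VectorMeasure.integral_dirac' hf.measurable.stronglyMeasurable]; simp
  have he : ∀ e, ∫ᵛ x, f x ∂•(Γ.edgeMeasure e).toSignedMeasure =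
      ∫ s in (0 : ℝ)..Γ.len e, f (Γ.pt e s) := fun e => by
    rw [integral_lsmul_toSignedMeasure, edgeMeasure,
      integral_map (Γ.continuous_pt e).measurable.aemeasurable
        hf.measurable.aestronglyMeasurable, intervalIntegral.integral_of_le (Γ.len_pos e).le]
  rw [explicitMeasure, VectorMeasure.integral_add_vectorMeasure (hi _) (hi _),
    VectorMeasure.integral_finsetSum_vectorMeasure fun _ _ => hi _, hd, canonicalFunctional]
  congr 1
  refine Finset.sum_congr rfl fun e _ => ?_
  rw [VectorMeasure.integral_add_vectorMeasure (hi _) (hi _),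
    VectorMeasure.integral_smul_vectorMeasure, VectorMeasure.integral_smul_vectorMeasure,
    VectorMeasure.integral_sub_vectorMeasure (hi _) (hi _),
    VectorMeasure.integral_sub_vectorMeasure (hi _) (hi _),
    VectorMeasure.integral_smul_vectorMeasure,
    VectorMeasure.integral_add_vectorMeasure (hi _) (hi _), hd, hd, he]
  simp only [smul_eq_mul]

/-- A Laplacian has total mass zero, so only `δ_o` counts. -/
lemma canonicalFunctional_const (o : V) (G : V → V → ℝ) (c : ℝ) :
    Γ.canonicalFunctional o G (fun _ => c) = c := by
  have : ∀ e, Γ.diagCoeff G e * (Γ.len e * c - Γ.len e / 2 * (c + c)) = 0 := fun e => by ring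
  simp [canonicalFunctional, this]

/-! ### Values of the canonical functional on the Green kernel, its diagonal and the resistance -/

lemma integral_tent {L t : ℝ} (h0 : 0 ≤ t) (h1 : t ≤ L) (hL : 0 < L) :
    ∫ s in (0 : ℝ)..L, min s t * (L - max s t) / L = t * (L - t) / 2 := by
  have hc : Continuous fun s => min s t * (L - max s t) / L := by fun_prop
  have e0 : ∫ s in (0 : ℝ)..t, min s t * (L - max s t) / L =
      ∫ s in (0 : ℝ)..t, s * ((L - t) / L) := intervalIntegral.integral_congr fun s hs => by
    rw [Set.uIcc_of_le h0] at hs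
    simp only [min_eq_left hs.2, max_eq_right hs.2, mul_div_assoc]
  have e1 : ∫ s in t..L, min s t * (L - max s t) / L =
      ∫ s in t..L, (t / L) * (L - s) := intervalIntegral.integral_congr fun s hs => by
    rw [Set.uIcc_of_le h1] at hs
    simp only [min_eq_right hs.1, max_eq_left hs.1]
    ring
  rw [← intervalIntegral.integral_add_adjacent_intervals (hc.intervalIntegrable 0 t)
    (hc.intervalIntegrable t L), e0, e1, intervalIntegral.integral_mul_const,
    intervalIntegral.integral_const_mul, intervalIntegral.integral_sub
      (Continuous.intervalIntegrable (by fun_prop) _ _)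
      (Continuous.intervalIntegrable (by fun_prop) _ _),
    intervalIntegral.integral_const]
  simp only [integral_id, smul_eq_mul]
  field_simp
  ring

lemma integral_affine (a b L : ℝ) : ∫ s in (0 : ℝ)..L, (a + b * s) = a * L + b * L ^ 2 / 2 := by
  rw [intervalIntegral.integral_add (Continuous.intervalIntegrable (by fun_prop) _ _)
    (Continuous.intervalIntegrable (by fun_prop) _ _),
    intervalIntegral.integral_const_mul, intervalIntegral.integral_const]
  simp only [integral_id, smul_eq_mul]
  ring

/-- The tent at `t` has integral `t * (L - t) / 2`, and `diagCoeff * t * (L - t)` is the deviation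
of the diagonal from its chord. -/
lemma sum_integral_edgeGreen {G : V → V → ℝ} (hG : ∀ v w, G v w = G w v) (x : Γ.Point) :
    ∑ e, Γ.diagCoeff G e * ∫ s in (0 : ℝ)..Γ.len e, Γ.edgeGreen x e s =
      (Γ.green G x x - Γ.interp (fun v => G v v) x) / 2 := by
  rcases x with v | ⟨e, t, ht⟩
  · simp [edgeGreen, green, interp]
  · rw [Finset.sum_eq_single e (fun e' _ he' => by simp [edgeGreen, Ne.symm he']) (by simp),
      edgeGreen_interior_self, integral_tent ht.1.le ht.2.le (Γ.len_pos e), ← Γ.pt_of_mem ht,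
      Γ.green_diag_pt hG ⟨ht.1.le, ht.2.le⟩, Γ.interp_pt _ ⟨ht.1.le, ht.2.le⟩]
    ring

/-- This is `g(x, o) + ⟨d, g_x⟩ / 2 = 1 + (d(x) - 1) / 2`, verified edge by edge. -/
lemma IsGreen.canonicalFunctional_green {o : V} {G : V → V → ℝ} (hG : Γ.IsGreen o G)
    (x : Γ.Point) : Γ.canonicalFunctional o G (Γ.green G x) = 1 / 2 + Γ.green G x x / 2 := by
  have hedge : ∀ e, ∫ s in (0 : ℝ)..Γ.len e, Γ.green G x (Γ.pt e s) =
      Γ.len e / 2 * (Γ.vertexGreen G x (Γ.src e) + Γ.vertexGreen G x (Γ.tgt e)) +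
        ∫ s in (0 : ℝ)..Γ.len e, Γ.edgeGreen x e s := fun e => by
    have hL := (Γ.len_pos e).ne'
    rw [intervalIntegral.integral_congr (g := fun s => (Γ.vertexGreen G x (Γ.src e) +
      Γ.edgeSlope (Γ.vertexGreen G x) e * s) + Γ.edgeGreen x e s) fun s hs => by
        rw [Set.uIcc_of_le (Γ.len_pos e).le] at hs
        exact Γ.green_pt_eq G x hs,
      intervalIntegral.integral_add (Continuous.intervalIntegrable (by fun_prop) _ _)
        ((Γ.continuous_edgeGreen x e).intervalIntegrable _ _), integral_affine, edgeSlope]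
    field_simp
    ring
  have ho : G o = fun _ => 1 := funext fun v => by rw [hG.symm, hG.base]
  have hen := hG.energy_vertexGreen x fun v => G v v
  rw [MetrizedGraph.energy] at hen
  have hterm : ∀ e, Γ.edgeSlope (fun v => G v v) e / 2 *
      (Γ.green G x (.vertex (Γ.tgt e)) - Γ.green G x (.vertex (Γ.src e))) +
      Γ.diagCoeff G e * ((∫ s in (0 : ℝ)..Γ.len e, Γ.green G x (Γ.pt e s)) -
      Γ.len e / 2 * (Γ.green G x (.vertex (Γ.src e)) + Γ.green G x (.vertex (Γ.tgt e)))) =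
      (Γ.vertexGreen G x (Γ.tgt e) - Γ.vertexGreen G x (Γ.src e)) *
        (G (Γ.tgt e) (Γ.tgt e) - G (Γ.src e) (Γ.src e)) / Γ.len e * (1 / 2) +
      Γ.diagCoeff G e * ∫ s in (0 : ℝ)..Γ.len e, Γ.edgeGreen x e s := fun e => by
    rw [hedge]
    simp only [green, vertexGreen, edgeSlope]
    ring
  rw [canonicalFunctional, Finset.sum_congr rfl fun e _ => hterm e, Finset.sum_add_distrib,
    ← Finset.sum_mul, hen, sum_integral_edgeGreen hG.symm, hG.base]
  simp only [green, ho, interp_const]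
  ring

lemma IsGreen.canonicalFunctional_diag {o : V} {G : V → V → ℝ} (hG : Γ.IsGreen o G) :
    Γ.canonicalFunctional o G (fun x => Γ.green G x x) =
      1 + Γ.edgePairing (Γ.diagDeriv G) (Γ.diagDeriv G) / 2 := by
  have hedge : ∀ e, ∫ s in (0 : ℝ)..Γ.len e, Γ.green G (Γ.pt e s) (Γ.pt e s) =
      Γ.len e / 2 * (G (Γ.src e) (Γ.src e) + G (Γ.tgt e) (Γ.tgt e)) +
        Γ.diagCoeff G e * (Γ.len e ^ 3 / 6) := fun e => by
    have hL := (Γ.len_pos e).ne'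
    rw [intervalIntegral.integral_congr (g := fun s => (G (Γ.src e) (Γ.src e) +
      (G (Γ.tgt e) (Γ.tgt e) - G (Γ.src e) (Γ.src e)) / Γ.len e * s) +
      Γ.diagCoeff G e * (s * (Γ.len e - s))) fun s hs => by
        rw [Set.uIcc_of_le (Γ.len_pos e).le] at hs
        exact Γ.green_diag_pt hG.symm hs,
      intervalIntegral.integral_add (Continuous.intervalIntegrable (by fun_prop) _ _)
        (Continuous.intervalIntegrable (by fun_prop) _ _), integral_affine,
      intervalIntegral.integral_const_mul, integral_mul_len_sub]
    field_simp
    ring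
  rw [edgePairing_diagDeriv, MetrizedGraph.energy, ← Finset.sum_add_distrib, Finset.sum_div,
    canonicalFunctional]
  congr 1
  · simp only [green, interp, hG.base]
  · refine Finset.sum_congr rfl fun e _ => ?_
    rw [hedge]
    simp only [green, interp, edgeSlope]
    ring

/-- By linearity the value is `d(x) + (1 + ⟨d, d⟩ / 2) - 2 * (1 / 2 + d(x) / 2)`, in which `d(x)`
cancels. -/
lemma IsGreen.canonicalFunctional_greenResistance {o : V} {G : V → V → ℝ} (hG : Γ.IsGreen o G)
    (x : Γ.Point) : Γ.canonicalFunctional o G (Γ.greenResistance G x) =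
      Γ.edgePairing (Γ.diagDeriv G) (Γ.diagDeriv G) / 2 := by
  have hdi : ∀ e, IntervalIntegrable (fun s => Γ.green G (Γ.pt e s) (Γ.pt e s)) volume 0
      (Γ.len e) := fun e =>
    ((hasEdgeDeriv_diag hG.symm).continuous.comp (Γ.continuous_pt e)).intervalIntegrable _ _
  have hgi : ∀ e, IntervalIntegrable (fun s => Γ.green G x (Γ.pt e s)) volume 0 (Γ.len e) :=
    fun e => ((Γ.continuous_green G x).comp (Γ.continuous_pt e)).intervalIntegrable _ _
  have hlin : Γ.canonicalFunctional o G (Γ.greenResistance G x) =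
      Γ.canonicalFunctional o G (fun _ => Γ.green G x x) +
      Γ.canonicalFunctional o G (fun y => Γ.green G y y) -
      2 * Γ.canonicalFunctional o G (Γ.green G x) := by
    simp only [canonicalFunctional, greenResistance]
    rw [mul_add, Finset.mul_sum, add_add_add_comm, add_sub_add_comm, ← Finset.sum_add_distrib,
      ← Finset.sum_sub_distrib]
    congr 1
    refine Finset.sum_congr rfl fun e _ => ?_
    rw [intervalIntegral.integral_sub (intervalIntegrable_const.add (hdi e))
      ((hgi e).const_mul 2), intervalIntegral.integral_add intervalIntegrable_const (hdi e),
      intervalIntegral.integral_const_mul]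
    ring
  rw [hlin, canonicalFunctional_const, hG.canonicalFunctional_diag, hG.canonicalFunctional_green]
  ring

/-! ### Existence of a canonical measure and independence of its constant -/

theorem IsGreen.isCanonicalMeasure_explicitMeasure [Finite V] {o : V} {G : V → V → ℝ}
    (hG : Γ.IsGreen o G) : Γ.IsCanonicalMeasure (Γ.explicitMeasure o G) := by
  obtain ⟨C, hC⟩ := exists_abs_greenResistance_le (Γ := Γ) G
  have h : ∀ x, Γ.measureVoltage (Γ.explicitMeasure o G) x x =
      Γ.edgePairing (Γ.diagDeriv G) (Γ.diagDeriv G) / 2 := fun x => by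
    simp only [measureVoltage, hG.voltage_diag, greenResistance_comm hG.symm _ x]
    rw [integral_explicitMeasure o G (continuous_greenResistance hG.symm x) (hC x),
      hG.canonicalFunctional_greenResistance]
  refine ⟨?_, fun x y => by rw [h, h]⟩
  rw [← signedMeasure_integral_one,
    integral_explicitMeasure o G continuous_const (C := 1) (by simp), canonicalFunctional_const]

/-- The functional consists of finitely many evaluations and edge integrals, so exchanging it with
`μ` needs only linearity and Fubini on each edge. -/
lemma IsGreen.integral_canonicalFunctional [Finite V] {o : V} {G : V → V → ℝ}
    (hG : Γ.IsGreen o G) (μ : SignedMeasure Γ.Point) :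
    ∫ᵛ ζ, Γ.canonicalFunctional o G (Γ.greenResistance G ζ) ∂•μ =
      Γ.canonicalFunctional o G (fun x => ∫ᵛ ζ, Γ.greenResistance G ζ x ∂•μ) := by
  obtain ⟨C, hC⟩ := exists_abs_greenResistance_le (Γ := Γ) G
  have hm : ∀ x, Measurable fun ζ => Γ.greenResistance G ζ x := fun x => by
    simp only [greenResistance_comm hG.symm _ x]
    exact (continuous_greenResistance hG.symm x).measurable
  have hi : ∀ x, μ.Integrable fun ζ => Γ.greenResistance G ζ x := fun x =>
    vectorMeasure_integrable_of_bounded μ (hm x) fun ζ => hC ζ x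
  -- Joint measurability follows from continuity in the edge parameter and measurability in `ζ`.
  have hk : ∀ e, Measurable (Function.uncurry fun ζ t => Γ.greenResistance G ζ (Γ.pt e t)) :=
    fun e => (measurable_uncurry_of_continuous_of_measurable
      (u := fun t ζ => Γ.greenResistance G ζ (Γ.pt e t))
      (fun ζ => (continuous_greenResistance hG.symm ζ).comp (Γ.continuous_pt e))
      fun t => hm (Γ.pt e t)).comp measurable_swap
  have hI : ∀ e, μ.Integrable fun ζ =>
      ∫ s in (0 : ℝ)..Γ.len e, Γ.greenResistance G ζ (Γ.pt e s) := fun e =>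
    vectorMeasure_integrable_of_bounded μ (measurable_intervalIntegral (hk e) (Γ.len_pos e).le)
      fun ζ => abs_intervalIntegral_le_of_bounded (fun t => hC ζ _) _ _
  have hA : ∀ e, μ.Integrable fun ζ => Γ.edgeSlope (fun v => G v v) e / 2 *
      (Γ.greenResistance G ζ (.vertex (Γ.tgt e)) - Γ.greenResistance G ζ (.vertex (Γ.src e))) :=
    fun e => ((hi _).sub (hi _)).const_mul _
  have hB : ∀ e, μ.Integrable fun ζ => Γ.len e / 2 *
      (Γ.greenResistance G ζ (.vertex (Γ.src e)) + Γ.greenResistance G ζ (.vertex (Γ.tgt e))) :=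
    fun e => ((hi _).add (hi _)).const_mul _
  have hmul : ∀ (c : ℝ) (f : Γ.Point → ℝ), ∫ᵛ ζ, c * f ζ ∂•μ = c * ∫ᵛ ζ, f ζ ∂•μ :=
    fun c f => VectorMeasure.integral_fun_smul μ _ c f
  have hD : ∀ e, μ.Integrable fun ζ => Γ.diagCoeff G e *
      ((∫ s in (0 : ℝ)..Γ.len e, Γ.greenResistance G ζ (Γ.pt e s)) - Γ.len e / 2 *
      (Γ.greenResistance G ζ (.vertex (Γ.src e)) + Γ.greenResistance G ζ (.vertex (Γ.tgt e)))) :=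
    fun e => ((hI e).sub (hB e)).const_mul _
  have hAD := fun e => VectorMeasure.Integrable.fun_add (hA e) (hD e)
  simp only [canonicalFunctional]
  rw [VectorMeasure.integral_fun_add (hi _)
      (VectorMeasure.Integrable.fun_finsetSum _ fun e _ => hAD e),
    VectorMeasure.integral_finsetSum _ fun e _ => hAD e]
  congr 1
  refine Finset.sum_congr rfl fun e _ => ?_
  rw [VectorMeasure.integral_fun_add (hA e) (hD e), hmul, hmul,
    VectorMeasure.integral_fun_sub (hi _) (hi _), VectorMeasure.integral_fun_sub (hI e) (hB e),
    hmul, VectorMeasure.integral_fun_add (hi _) (hi _),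
    signedMeasure_integral_intervalIntegral μ (hk e) (fun ζ t => hC ζ _) (Γ.len_pos e).le]

/-- The constant value of `j_μ(x, x)` is the same for all canonical measures `μ`. -/
theorem IsGreen.measureVoltage_eq [Finite V] {o : V} {G : V → V → ℝ} (hG : Γ.IsGreen o G)
    {μ : SignedMeasure Γ.Point} (hμ : Γ.IsCanonicalMeasure μ) (x : Γ.Point) :
    Γ.measureVoltage μ x x = Γ.edgePairing (Γ.diagDeriv G) (Γ.diagDeriv G) / 2 := by
  -- The left side integrates the constant `⟨d, d⟩ / 2` against total mass 1; the right side is the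
  -- functional of a constant, hence that constant.
  have h := hG.integral_canonicalFunctional μ
  have hfun : (fun y => ∫ᵛ ζ, Γ.greenResistance G ζ y ∂•μ) =
      fun _ => Γ.measureVoltage μ x x := by
    funext y
    rw [hμ.2 x y]
    simp only [measureVoltage, hG.voltage_diag]
  rw [hfun, canonicalFunctional_const] at h
  rw [← h]
  simp only [hG.canonicalFunctional_greenResistance]
  have := isFiniteMeasure_variation μ
  rw [VectorMeasure.integral_const, hμ.1]
  simp

theorem IsGreen.tau_eq [Finite V] {o : V} {G : V → V → ℝ} (hG : Γ.IsGreen o G) :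
    Γ.tau = Γ.edgePairing (Γ.diagDeriv G) (Γ.diagDeriv G) / 4 := by
  -- Existence excludes the default value 0 of `canonicalMeasure`.
  have hex : ∃ μ, Γ.IsCanonicalMeasure μ := ⟨_, hG.isCanonicalMeasure_explicitMeasure⟩
  have hμ : Γ.IsCanonicalMeasure Γ.canonicalMeasure := by
    rw [canonicalMeasure, dif_pos hex]; exact hex.choose_spec
  rw [tau, hG.measureVoltage_eq hμ]
  ring

end Canonical

end MetrizedGraph

/-! ### The formula for the tau constant -/

theorem mainTheorem8 {V E : Type*} [Finite V] [Fintype E] (Γ : MetrizedGraph V E) :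
    (∀ p q : Γ.Point,
      Γ.HasDerivSqIntegral (fun x => Γ.voltage x p q) ∧
      Γ.tau = 1 / 4 * Γ.derivSqIntegral (fun x => Γ.voltage x p q) + Γ.resistance p q / 4) ∧
    (∀ p : Γ.Point,
      Γ.HasDerivSqIntegral (fun x => Γ.resistance x p) ∧
      Γ.tau = 1 / 4 * Γ.derivSqIntegral (fun x => Γ.resistance x p)) := by
  obtain ⟨o, G, hG⟩ := Γ.exists_isGreen
  have h : ∀ p q : Γ.Point, Γ.HasDerivSqIntegral (fun x => Γ.voltage x p q) ∧
      Γ.tau = 1 / 4 * Γ.derivSqIntegral (fun x => Γ.voltage x p q) + Γ.resistance p q / 4 := by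
    intro p q
    obtain ⟨h1, h2⟩ := hG.derivSqIntegral_voltage p q
    refine ⟨h1, ?_⟩
    rw [hG.tau_eq, ← h2]
    ring
  -- By definition `resistance x p` is `voltage x p p`, so the case `q = p` applies verbatim.
  refine ⟨h, fun p => ⟨(h p p).1, ?_⟩⟩
  have hpp : Γ.resistance p p = 0 := by rw [hG.resistance_eq]; ring
  have := (h p p).2
  rw [hpp, zero_div, add_zero] at this
  exact this
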